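/- **System DR.** Roles are $R ::= \mathsf{Nom}\mid\mathsf{Rep}$, ordered by $\mathsf{Nom}\le\mathsf{Rep}$, with minimum $R_1\wedge R_2$. Relevances are $\rho::=+\mid-$, term flags $\nu::=R\mid\rho$, and flags $\upsilon::=\nu\mid\bullet$. Terms and types (up to renaming of bound variables) are $$a,b,A,B ::= \star\mid x\mid F\mid\lambda^{\rho}x.b\mid a\,b^{\nu}\mid\Box\mid\Pi^{\rho}x{:}A.B\mid\Lambda c.b\mid a\,\bullet\mid\forall c{:}\phi.B\mid \mathsf{case}\ a\ \mathsf{of}\ F\,\bar\upsilon\to b_1\,\|\,\_\to b_2,$$ with propositions $\phi::= a\sim_R b:A$. The coercion variables $c$ do not occur in terms other than as binders. Contexts $\Gamma$ are finite lists of entries $x{:}A$ and $c{:}\phi$; $\widetilde\Gamma$ is the set of variables bound by $\Gamma$; $\Delta$ is a finite set of variables. Patterns are $p::=F\mid p\,x^{R}\mid p\,x^{+}\mid p\,\Box^{-}\mid p\,\bullet$. A signature is a finite list of declarations $F:A\,@\,\bar R$ and $F:A\,@\,\bar R\ \mathsf{where}\ p\sim_R a$. Fix a signature $\Sigma_0$.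 Variables introduced by a binder or by a context extension are always taken fresh. *Paths and values.* $\mathsf{Roles}(F)=\bar R$ if $F$ is declared with $@\,\bar R$; if $\mathsf{Roles}(a)=R,\bar R$ then $\mathsf{Roles}(a\,b^{R})=\bar R$; if $\mathsf{Roles}(a)=\mathsf{Nom},\bar R$ then $\mathsf{Roles}(a\,b^{+})=\bar R$; and $\mathsf{Roles}(a\,\Box^-)=\mathsf{Roles}(a\,\bullet)=\mathsf{Roles}(a)$. A path headed by $F$ is a declared constant $F$ applied to any number of arguments $b^R$, $b^+$, $\Box^-$, $\bullet$. A term matches a pattern if it is obtained from it by putting terms for the pattern variables. $\mathsf{CasePath}_R\,a=F$ means that $a$ is a path headed by $F$ and that $F$ has no axiom, or has an axiom $p\sim_{R_1}b$ where $R_1\not\le R$ or no prefix of $a$ matches $p$. The values at role $R$ are $\star$, $\Pi$-types, $\forall$-types, $\lambda^+x.b$, $\Lambda c.b$, those $\lambda^-x.b$ whose body $b$ is a value at $R$, and the $a$ with $\mathsf{CasePath}_R\,a=F$ for some $F$. *Case analysis.* $a\leftrightarrow_R F\,\bar\upsilon$ means that $a$ is $F$ applied to arguments with exactly the flags $\bar\upsilon$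 (with argument $\Box$ for the flag $-$), where $F$ is declared and either has no axiom or has one at a role $R_1\not\le R$. $\mathsf{Sat}(F,\bar\upsilon)$ means that the roles declared for $F$ are exactly the roles in $\bar\upsilon$, in order, where $+$ counts as $\mathsf{Nom}$ and $-$ and $\bullet$ are skipped. $\mathsf{Branch}(\bar\upsilon;a{:}A;b{:}A_1)=(B\mid C)$ is the relation given by: for $\bar\upsilon$ empty, $A_1=A$ and $B=\forall c{:}(a\sim_{\mathsf{Nom}}b:A).C$; for $\bar\upsilon=R,\bar\upsilon'$ or $+,\bar\upsilon'$, $A_1=\Pi^+x{:}A_2.A_3$ and $B=\Pi^+x{:}A_2.B'$ with $\mathsf{Branch}(\bar\upsilon';a{:}A;b\,x^{R}\text{ (resp. }b\,x^{+}){:}A_3)=(B'\mid C)$; for $-,\bar\upsilon'$ the same with $\Pi^-$ and $b\,\Box^-$; for $\bullet,\bar\upsilon'$ the same with $\forall c{:}\phi$ in place of $\Pi^+x{:}A_2$ and with $b\,\bullet$. Here $x\notin\mathrm{fv}(a,A,b,C)$. *Primitive reduction* $a\to^\beta_R b$: $(\lambda^\rho x.v)\,b^\rho\to^\beta_R v\{b/x\}$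 if $\lambda^\rho x.v$ is a value at $R$; $(\Lambda c.b)\,\bullet\to^\beta_R b$; if $F:A\,@\,\bar R\ \mathsf{where}\ p\sim_{R_1}b$ is in $\Sigma_0$, $R_1\le R$ and $a$ matches $p$ with substitution $\sigma$, then $a\to^\beta_R b\sigma$; if $\mathsf{Sat}(F,\bar\upsilon)$ and $a\leftrightarrow_{\mathsf{Nom}}F\,\bar\upsilon$, then $\mathsf{case}\ a\ \mathsf{of}\ F\,\bar\upsilon\to b_1\|\_\to b_2\ \to^\beta_R\ b_1'\,\bullet$, where $b_1'$ is $b_1$ applied to the arguments of $a$ in order, with role flags replaced by $+$; if $\mathsf{Sat}(F,\bar\upsilon)$, $a$ is a value at $\mathsf{Nom}$ and not $a\leftrightarrow_{\mathsf{Nom}}F\,\bar\upsilon$, the same term reduces to $b_2$. The following judgments are the least relations closed under the listed rules ("$P_1,P_2\Rightarrow Q$": from $P_1,P_2$ infer $Q$). *Well-formed contexts* $\vDash\Gamma$ and *propositions* $\Gamma\vDash\phi\ \mathsf{ok}$: $\vDash\varnothing$; $\vDash\Gamma,\ \Gamma\vDash A:\star,\ x\notin\widetilde\Gamma\Rightarrow\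 \vDash\Gamma,x{:}A$; $\vDash\Gamma,\ \Gamma\vDash\phi\ \mathsf{ok},\ c\notin\widetilde\Gamma\Rightarrow\ \vDash\Gamma,c{:}\phi$; $\Gamma\vDash a:A,\ \Gamma\vDash b:A,\ \Gamma\vDash A:\star\Rightarrow\Gamma\vDash(a\sim_R b:A)\ \mathsf{ok}$. *Typing* $\Gamma\vDash a:A$: - $\vDash\Gamma\Rightarrow\Gamma\vDash\star:\star$; $\ \vDash\Gamma,\ x{:}A\in\Gamma\Rightarrow\Gamma\vDash x:A$. - $\Gamma,x{:}A\vDash B:\star,\ \Gamma\vDash A:\star\Rightarrow\Gamma\vDash\Pi^\rho x{:}A.B:\star$. - $\Gamma,x{:}A\vDash a:B,\ \Gamma\vDash A:\star$, and $x\notin\mathrm{fv}(a)$ if $\rho=-$, $\Rightarrow\Gamma\vDash\lambda^\rho x.a:\Pi^\rho x{:}A.B$. - $\Gamma\vDash b:\Pi^+x{:}A.B,\ \Gamma\vDash a:A\Rightarrow\Gamma\vDash b\,a^+:B\{a/x\}$; if moreover $\mathsf{Roles}(b)=R,\bar R$, then $\Gamma\vDash b\,a^R:B\{a/x\}$. -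 $\Gamma\vDash b:\Pi^-x{:}A.B,\ \Gamma\vDash a:A\Rightarrow\Gamma\vDash b\,\Box^-:B\{a/x\}$. - $\Gamma\vDash a:A,\ \Gamma;\widetilde\Gamma\vDash A\equiv_{\mathsf{Rep}}B:\star,\ \Gamma\vDash B:\star\Rightarrow\Gamma\vDash a:B$. - $\Gamma,c{:}\phi\vDash B:\star,\ \Gamma\vDash\phi\ \mathsf{ok}\Rightarrow\Gamma\vDash\forall c{:}\phi.B:\star$; $\ \Gamma,c{:}\phi\vDash d:B,\ \Gamma\vDash\phi\ \mathsf{ok}\Rightarrow\Gamma\vDash\Lambda c.d:\forall c{:}\phi.B$. - $\Gamma\vDash d:\forall c{:}(a\sim_Rb:A).B,\ \Gamma;\widetilde\Gamma\vDash a\equiv_Rb:A\Rightarrow\Gamma\vDash d\,\bullet:B$. - $\vDash\Gamma$, $F$ is declared with type $A$ (with or without an axiom), $\varnothing\vDash A:\star\Rightarrow\Gamma\vDash F:A$. - $\Gamma\vDash a:A,\ \Gamma\vDash F:A_1,\ \mathsf{Branch}(\bar\upsilon;a{:}A;F{:}A_1)=(B\mid C),\ \mathsf{Sat}(F,\bar\upsilon),\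 \Gamma\vDash b_1:B,\ \Gamma\vDash b_2:C\Rightarrow\Gamma\vDash\mathsf{case}\ a\ \mathsf{of}\ F\,\bar\upsilon\to b_1\|\_\to b_2:C$. *Equality of propositions* $\Gamma;\Delta\vDash\phi_1\equiv\phi_2$: - $\Gamma;\Delta\vDash a_1\equiv_Ra_2:A,\ \Gamma;\Delta\vDash b_1\equiv_Rb_2:A\Rightarrow\Gamma;\Delta\vDash(a_1\sim_Rb_1:A)\equiv(a_2\sim_Rb_2:A)$. - $\Gamma;\Delta\vDash A\equiv_{\mathsf{Rep}}B:\star$ and both propositions well-formed in $\Gamma$ $\Rightarrow\Gamma;\Delta\vDash(a\sim_Rb:A)\equiv(a\sim_Rb:B)$. - $\Gamma;\Delta\vDash\forall c{:}\phi_1.B_1\equiv_R\forall c{:}\phi_2.B_2:\star\Rightarrow\Gamma;\Delta\vDash\phi_1\equiv\phi_2$. *Definitional equality* $\Gamma;\Delta\vDash a\equiv_Rb:A$ (all judgments below are under $\Gamma;\Delta$ unless shown otherwise): - Reflexivity for well-typed terms at every role, symmetry, transitivity, and $a\equiv_{R_1}b:A,\ R_1\le R_2\Rightarrow a\equiv_{R_2}b:A$.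 - $\vDash\Gamma,\ (c{:}(a\sim_Rb:A))\in\Gamma,\ c\in\Delta\Rightarrow a\equiv_Rb:A$. - $\Gamma\vDash a:A,\ \Gamma\vDash b:A,\ a\to^\beta_Rb\Rightarrow a\equiv_Rb:A$. - $A_1\equiv_RA_2:\star,\ \Gamma,x{:}A_1;\Delta\vDash B_1\equiv_RB_2:\star,\ \Gamma\vDash A_1:\star$, both $\Pi$-types of type $\star$ in $\Gamma$ $\Rightarrow\Pi^\rho x{:}A_1.B_1\equiv_R\Pi^\rho x{:}A_2.B_2:\star$. - $\Gamma,x{:}A;\Delta\vDash b_1\equiv_Rb_2:B,\ \Gamma\vDash A:\star$, and $x\notin\mathrm{fv}(b_1,b_2)$ if $\rho=-$, $\Rightarrow\lambda^\rho x.b_1\equiv_R\lambda^\rho x.b_2:\Pi^\rho x{:}A.B$. - $a_1\equiv_Rb_1:\Pi^+x{:}A.B,\ a_2\equiv_{\mathsf{Nom}}b_2:A\Rightarrow a_1\,a_2^+\equiv_Rb_1\,b_2^+:B\{a_2/x\}$. - $a_1\equiv_{R'}b_1:\Pi^+x{:}A.B,\ a_2\equiv_{R\wedge R'}b_2:A,\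 \mathsf{Roles}(a_1)=R,\bar R,\ \mathsf{Roles}(b_1)=R,\bar R',\ \Gamma\vDash b_1\,b_2^R:B\{a_2/x\}\Rightarrow a_1\,a_2^R\equiv_{R'}b_1\,b_2^R:B\{a_2/x\}$. - $a_1\equiv_Rb_1:\Pi^-x{:}A.B,\ \Gamma\vDash a:A\Rightarrow a_1\,\Box^-\equiv_Rb_1\,\Box^-:B\{a/x\}$. - $\Pi^\rho x{:}A_1.B_1\equiv_R\Pi^\rho x{:}A_2.B_2:\star\Rightarrow A_1\equiv_RA_2:\star$; if moreover $a_1\equiv_{\mathsf{Nom}}a_2:A_1$, then $B_1\{a_1/x\}\equiv_RB_2\{a_2/x\}:\star$. - $\phi_1\equiv\phi_2,\ \Gamma,c{:}\phi_1;\Delta\vDash B_1\equiv_RB_2:\star,\ \Gamma\vDash\phi_1\ \mathsf{ok}$, both $\forall$-types of type $\star$ in $\Gamma$ $\Rightarrow\forall c{:}\phi_1.B_1\equiv_R\forall c{:}\phi_2.B_2:\star$; $\ \Gamma,c{:}\phi;\Delta\vDash d_1\equiv_Rd_2:B,\ \Gamma\vDash\phi\ \mathsf{ok}\Rightarrow\Lambda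 c.d_1\equiv_R\Lambda c.d_2:\forall c{:}\phi.B$. - $d_1\equiv_Rd_2:\forall c{:}(a\sim_{R_1}b:A).B,\ \Gamma;\widetilde\Gamma\vDash a\equiv_{R_1}b:A\Rightarrow d_1\,\bullet\equiv_Rd_2\,\bullet:B$. - $\forall c{:}(a_1\sim_{R_1}b_1:A_1).B_1\equiv_R\forall c{:}(a_2\sim_{R_2}b_2:A_2).B_2:\star$ and $\Gamma;\widetilde\Gamma\vDash a_i\equiv_{R_i}b_i:A_i$ for $i=1,2$ $\Rightarrow B_1\equiv_RB_2:\star$. - $a\equiv_Rb:A,\ (a\sim_Rb:A)\equiv(a'\sim_{R'}b':A')\Rightarrow a'\equiv_{R'}b':A'$; $\ (a\sim_Rb:A)\equiv(a'\sim_{R'}b':A')\Rightarrow A\equiv_{\mathsf{Rep}}A':\star$. - $a\equiv_Rb:A,\ \Gamma;\widetilde\Gamma\vDash A\equiv_{\mathsf{Rep}}B:\star\Rightarrow a\equiv_Rb:B$. - $a\equiv_{\mathsf{Nom}}a':A,\ \Gamma\vDash F:A_1,\ \mathsf{Branch}(\bar\upsilon;a{:}A;F{:}A_1)=(B\mid C),\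 \mathsf{Branch}(\bar\upsilon;a'{:}A;F{:}A_1)=(B'\mid C),\ \mathsf{Sat}(F,\bar\upsilon),\ \Gamma;\widetilde\Gamma\vDash B\equiv_{\mathsf{Rep}}B':\star,\ b_1\equiv_Rb_1':B,\ b_2\equiv_Rb_2':C\Rightarrow\mathsf{case}\ a\ \mathsf{of}\ F\,\bar\upsilon\to b_1\|\_\to b_2\equiv_R\mathsf{case}\ a'\ \mathsf{of}\ F\,\bar\upsilon\to b_1'\|\_\to b_2':C$. - If $\mathsf{CasePath}_{R_2}(a\,b^{R_1})=F=\mathsf{CasePath}_{R_2}(a'\,b'^{R_1})$, $\Gamma\vDash a,a':\Pi^+x{:}A.B$, $\Gamma\vDash b,b':A$, $a\,b^{R_1}\equiv_{R_2}a'\,b'^{R_1}:B\{b/x\}$ and $\Gamma;\widetilde\Gamma\vDash B\{b/x\}\equiv_{\mathsf{Rep}}B\{b'/x\}:\star$, then $a\equiv_{R_2}a':\Pi^+x{:}A.B$ and $b\equiv_{R_1\wedge R_2}b':A$. - If $\mathsf{CasePath}_R(a\,\Box^-)=F=\mathsf{CasePath}_R(a'\,\Box^-)$, $\Gamma\vDash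 a,a':\Pi^-x{:}A.B$, $\Gamma\vDash b,b':A$, $a\,\Box^-\equiv_Ra'\,\Box^-:B\{b/x\}$ and $\Gamma;\widetilde\Gamma\vDash B\{b/x\}\equiv_{\mathsf{Rep}}B\{b'/x\}:\star$, then $a\equiv_Ra':\Pi^-x{:}A.B$. - If $\mathsf{CasePath}_R(d\,\bullet)=F=\mathsf{CasePath}_R(d'\,\bullet)$, $\Gamma\vDash d,d':\forall c{:}(a\sim_{R_1}b:A).B$, $\Gamma;\widetilde\Gamma\vDash a\equiv_{R_1}b:A$ and $d\,\bullet\equiv_Rd'\,\bullet:B$, then $d\equiv_Rd':\forall c{:}(a\sim_{R_1}b:A).B$. *Well-formed signatures.* Role-checking $\Omega\vDash a:R$, with $\Omega$ a list of entries $x{:}R$: $\star$, $\Box$ and declared constants check at every $R$; $x$ checks at $R$ if $(x{:}R')\in\Omega$ with $R'\le R$; $\lambda^\rho x.b$, and $\Pi^\rho x{:}A.B$, check at $R$ if $b$, respectively $A$ and $B$, do, where $x{:}\mathsf{Nom}$ is added to $\Omega$ for $b$ and $B$; $a\,b^\rho$ checks at $R$ if $a$ does and $b$ checks at $\mathsf{Nom}$;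 $a\,b^{R_1}$ checks at $R$ if $a$ does, $\mathsf{Roles}(a)=R_1,\bar R$ and $b$ checks at $R_1\wedge R$; $\Lambda c.b$ and $b\,\bullet$ check at $R$ if $b$ does; $\forall c{:}(a\sim_{R_1}b:A).B$ checks at $R$ if $a,b,A$ check at $R_1$ and $B$ at $R$; a case expression checks at $R$ if its scrutinee checks at $\mathsf{Nom}$ and its branches at $R$. For a pattern $p$ headed by $F:A$, $\mathsf{PatCtx}(p,F{:}A)=\Gamma;B;\Omega$ is defined from $\mathsf{PatCtx}(F,F{:}A)=\varnothing;A;\varnothing$ by: if $\mathsf{PatCtx}(p,F{:}A)=\Gamma;\Pi^+x{:}A'.B;\Omega$ then $p\,x^R$ yields $\Gamma,x{:}A';B;\Omega,x{:}R$ and $p\,x^+$ yields $\Gamma,x{:}A';B;\Omega,x{:}\mathsf{Nom}$; if it is $\Gamma;\Pi^-x{:}A'.B;\Omega$ then $p\,\Box^-$ yields $\Gamma,x{:}A';B;\Omega$; if it is $\Gamma;\forall c{:}\phi.B;\Omega$ then $p\,\bullet$ yields $\Gamma,c{:}\phi;B;\Omega$. The signature $\Sigma_0$ is *well-formed*, $\vDash\Sigma_0$,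 if its constants are pairwise distinct, $\varnothing\vDash A:\star$ for the type $A$ of each declaration, and for each $F:A\,@\,\bar R\ \mathsf{where}\ p\sim_Ra$ there are $\Gamma,B,\Omega$ with $\mathsf{PatCtx}(p,F{:}A)=\Gamma;B;\Omega$, $\Gamma\vDash a:B$, $\Omega\vDash a:R$, and $\bar R$ the list of roles in $\Omega$. (All judgments refer to the whole of $\Sigma_0$, so definitions may be recursive.) *Context equality* $\vDash\Gamma_1\equiv\Gamma_2$: $\vDash\varnothing\equiv\varnothing$; $\vDash\Gamma_1\equiv\Gamma_2,\ \Gamma_1;\widetilde{\Gamma_1}\vDash A_1\equiv_{\mathsf{Rep}}A_2:\star\Rightarrow\ \vDash(\Gamma_1,x{:}A_1)\equiv(\Gamma_2,x{:}A_2)$; $\vDash\Gamma_1\equiv\Gamma_2,\ \Gamma_1;\widetilde{\Gamma_1}\vDash\phi_1\equiv\phi_2\Rightarrow\ \vDash(\Gamma_1,c{:}\phi_1)\equiv(\Gamma_2,c{:}\phi_2)$. **Lemma (Context Conversion).** Suppose $\vDash\Sigma_0$. For all contexts $\Gamma_1,\Gamma_2$ and terms $a,A$: if $\Gamma_1\vDash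 a:A$ and $\vDash\Gamma_1\equiv\Gamma_2$, then $\Gamma_2\vDash a:A$. -/

import Mathlib

namespace DR

/-! # System DR: a dependently typed calculus with roles

Binding is represented in locally nameless style: bound term variables are de Bruijn indices, free
variables are names, and premises under a binder are quantified over all names outside some finite
set. Coercion variables never occur in terms (every coercion in a term is the trivial one), so the
binders `Λ c. b` and `∀ c : φ. B` do not bind any index; coercion variables live only in contexts
and in the sets `Δ` of available coercion variables. -/

/-- Names of term and coercion variables. -/
abbrev Name := ℕ

/-- Names of constants. -/
abbrev Const := ℕ

inductive Role
  | nom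
  | rep

/-- The order on roles, with bottom `nom` and top `rep`. -/
def Role.le : Role → Role → Prop
  | .rep, .nom => False
  | _, _ => True

/-- The minimum of two roles. -/
def Role.meet : Role → Role → Role
  | .rep, .rep => .rep
  | _, _ => .nom

/-- Relevance `ρ`: relevant is `+`, irrelevant is `-`. -/
inductive Relevance
  | rel
  | irr

/-- Application flags `ν` for term arguments: a role or a relevance. -/
inductive Flag
  | role (R : Role)
  | rho (ρ : Relevance)

/-- Application flags `υ` for arbitrary arguments: `ν`, or `•` for a coercion argument. -/
inductive AnyFlag
  | tm (ν : Flag)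
  | co

/-- Terms and types. -/
inductive Tm
  | star
  | bvar (i : ℕ)
  | fvar (x : Name)
  | const (F : Const)
  /-- `λ^ρ x. b` -/
  | lam (ρ : Relevance) (b : Tm)
  /-- `a b^ν` -/
  | app (a : Tm) (ν : Flag) (b : Tm)
  /-- the trivial term `□` that stands for an irrelevant argument -/
  | box
  /-- `Π^ρ x : A. B` -/
  | pi (ρ : Relevance) (A B : Tm)
  /-- `Λ c. b` -/
  | clam (b : Tm)
  /-- `a •` -/
  | capp (a : Tm)
  /-- `∀ c : (a ∼_R b : A). B` -/
  | cpi (a b A : Tm) (R : Role) (B : Tm)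
  /-- `case a of F υs → b₁ ‖ _ → b₂` -/
  | case (a : Tm) (F : Const) (υs : List AnyFlag) (b₁ b₂ : Tm)

/-- Equality propositions `lhs ∼_R rhs : ty`. -/
structure Constraint where
  lhs : Tm
  rhs : Tm
  ty : Tm
  R : Role

/-- Replace the index `k` by the (locally closed) term `u`. -/
def Tm.openRec (u : Tm) : ℕ → Tm → Tm
  | _, .star => .star
  | k, .bvar i => if i = k then u else .bvar i
  | _, .fvar x => .fvar x
  | _, .const F => .const F
  | k, .lam ρ b => .lam ρ (openRec u (k + 1) b)
  | k, .app a ν b => .app (openRec u k a) ν (openRec u k b)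
  | _, .box => .box
  | k, .pi ρ A B => .pi ρ (openRec u k A) (openRec u (k + 1) B)
  | k, .clam b => .clam (openRec u k b)
  | k, .capp a => .capp (openRec u k a)
  | k, .cpi a b A R B =>
      .cpi (openRec u k a) (openRec u k b) (openRec u k A) R (openRec u k B)
  | k, .case a F υs b₁ b₂ => .case (openRec u k a) F υs (openRec u k b₁) (openRec u k b₂)

/-- `B.inst u` is `B{u/x}`, where `x` is the variable bound by the binder that `B` is the body of. -/
def Tm.inst (B u : Tm) : Tm := Tm.openRec u 0 B

/-- `B.opn x` is the body `B` of a binder whose variable is named `x`. -/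
def Tm.opn (B : Tm) (x : Name) : Tm := B.inst (.fvar x)

/-- Simultaneous substitution of (locally closed) terms for free variables. -/
def Tm.subst (σ : Name → Tm) : Tm → Tm
  | .star => .star
  | .bvar i => .bvar i
  | .fvar x => σ x
  | .const F => .const F
  | .lam ρ b => .lam ρ (subst σ b)
  | .app a ν b => .app (subst σ a) ν (subst σ b)
  | .box => .box
  | .pi ρ A B => .pi ρ (subst σ A) (subst σ B)
  | .clam b => .clam (subst σ b)
  | .capp a => .capp (subst σ a)
  | .cpi a b A R B => .cpi (subst σ a) (subst σ b) (subst σ A) R (subst σ B)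
  | .case a F υs b₁ b₂ => .case (subst σ a) F υs (subst σ b₁) (subst σ b₂)

/-- Free variables. -/
def Tm.fv : Tm → Finset Name
  | .star => ∅
  | .bvar _ => ∅
  | .fvar x => {x}
  | .const _ => ∅
  | .lam _ b => fv b
  | .app a _ b => fv a ∪ fv b
  | .box => ∅
  | .pi _ A B => fv A ∪ fv B
  | .clam b => fv b
  | .capp a => fv a
  | .cpi a b A _ B => fv a ∪ fv b ∪ fv A ∪ fv B
  | .case a _ _ b₁ b₂ => fv a ∪ fv b₁ ∪ fv b₂

/-- Patterns of axioms: `F`, `p x^R`, `p x^+`, `p □^-` and `p •`. -/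
inductive Pat
  | const (F : Const)
  | appRole (p : Pat) (R : Role) (x : Name)
  | appRel (p : Pat) (x : Name)
  | appIrr (p : Pat)
  | capp (p : Pat)

/-- Context entries `x : A` and `c : φ`. -/
inductive Entry
  | tm (A : Tm)
  | co (φ : Constraint)

/-- Contexts; the most recent entry comes first. -/
abbrev Context := List (Name × Entry)

/-- The domain of a context. -/
def dom (Γ : Context) : Finset Name := (Γ.map Prod.fst).toFinset

/-- Signature entries: `A @ Rs`, and `A @ Rs where p ∼_R a`. -/
inductive Decl
  | cs (A : Tm) (Rs : List Role)
  | ax (A : Tm) (Rs : List Role) (p : Pat) (R : Role) (a : Tm)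

abbrev Signature := List (Const × Decl)

/-! ### Paths, patterns and values -/

/-- `Roles S a Rs`: the term `a` is a path whose head is declared in `S`, and `Rs` are the declared
roles of the parameters that `a` has not yet been applied to. The flag `+` counts as `nom`. -/
inductive Roles (S : Signature) : Tm → List Role → Prop
  | absConst {F A Rs} : (F, .cs A Rs) ∈ S → Roles S (.const F) Rs
  | const {F A Rs p R a} : (F, .ax A Rs p R a) ∈ S → Roles S (.const F) Rs
  | tapp {a b R Rs} : Roles S a (R :: Rs) → Roles S (.app a (.role R) b) Rs
  | app {a b Rs} : Roles S a (.nom :: Rs) → Roles S (.app a (.rho .rel) b) Rs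
  | iapp {a Rs} : Roles S a Rs → Roles S (.app a (.rho .irr) .box) Rs
  | capp {a Rs} : Roles S a Rs → Roles S (.capp a) Rs

/-- `Head S a F`: the term `a` is an application path headed by the declared constant `F`. -/
inductive Head (S : Signature) : Tm → Const → Prop
  | absConst {F A Rs} : (F, .cs A Rs) ∈ S → Head S (.const F) F
  | const {F A Rs p R a} : (F, .ax A Rs p R a) ∈ S → Head S (.const F) F
  | tapp {a b R F} : Head S a F → Head S (.app a (.role R) b) F
  | app {a b F} : Head S a F → Head S (.app a (.rho .rel) b) F
  | iapp {a F} : Head S a F → Head S (.app a (.rho .irr) .box) F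
  | capp {a F} : Head S a F → Head S (.capp a) F

/-- `PatMatch a p σ`: the term `a` matches the pattern `p`, with matching substitution `σ` (the
identity outside the variables of `p`). -/
inductive PatMatch : Tm → Pat → (Name → Tm) → Prop
  | const {F} : PatMatch (.const F) (.const F) Tm.fvar
  | appRole {a b p R x σ} : PatMatch a p σ →
      PatMatch (.app a (.role R) b) (.appRole p R x) (Function.update σ x b)
  | appRel {a b p x σ} : PatMatch a p σ →
      PatMatch (.app a (.rho .rel) b) (.appRel p x) (Function.update σ x b)
  | appIrr {a p σ} : PatMatch a p σ → PatMatch (.app a (.rho .irr) .box) (.appIrr p) σ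
  | capp {a p σ} : PatMatch a p σ → PatMatch (.capp a) (.capp p) σ

/-- Some prefix of the path `a` matches the pattern `p`. -/
inductive PrefixMatch : Tm → Pat → Prop
  | base {a p σ} : PatMatch a p σ → PrefixMatch a p
  | app {a ν b p} : PrefixMatch a p → PrefixMatch (.app a ν b) p
  | capp {a p} : PrefixMatch a p → PrefixMatch (.capp a) p

/-- `CasePath S R a F`: the term `a` is a path headed by `F` that cannot reduce at role `R`. -/
inductive CasePath (S : Signature) : Role → Tm → Const → Prop
  | absConst {R a F A Rs} : Head S a F → (F, .cs A Rs) ∈ S → CasePath S R a F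
  | const {R a F A Rs p R₁ b} : Head S a F → (F, .ax A Rs p R₁ b) ∈ S → ¬ R₁.le R →
      CasePath S R a F
  | unMatch {R a F A Rs p R₁ b} : Head S a F → (F, .ax A Rs p R₁ b) ∈ S → ¬ PrefixMatch a p →
      CasePath S R a F

/-- Values at a role. -/
inductive Value (S : Signature) : Role → Tm → Prop
  | star {R} : Value S R .star
  | pi {R ρ A B} : Value S R (.pi ρ A B)
  | cpi {R a b A R₁ B} : Value S R (.cpi a b A R₁ B)
  | lamRel {R b} : Value S R (.lam .rel b)
  | lamIrr {R b} (L : Finset Name) : (∀ x ∉ L, Value S R (b.opn x)) → Value S R (.lam .irr b)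
  | clam {R b} : Value S R (.clam b)
  | path {R a F} : CasePath S R a F → Value S R a

/-! ### Case analysis and primitive reduction -/

/-- `AppsPath S R a F υs` (written `a ↔_R F υs`): `a` is the constant `F`, which does not unfold
at role `R`, applied to arguments of exactly the form `υs`. -/
inductive AppsPath (S : Signature) : Role → Tm → Const → List AnyFlag → Prop
  | absConst {R F A Rs} : (F, .cs A Rs) ∈ S → AppsPath S R (.const F) F []
  | const {R F A Rs p R₁ b} : (F, .ax A Rs p R₁ b) ∈ S → ¬ R₁.le R → AppsPath S R (.const F) F []
  | tapp {R a b F R₁ υs} : AppsPath S R a F υs →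
      AppsPath S R (.app a (.role R₁) b) F (υs ++ [.tm (.role R₁)])
  | app {R a b F υs} : AppsPath S R a F υs →
      AppsPath S R (.app a (.rho .rel) b) F (υs ++ [.tm (.rho .rel)])
  | iapp {R a F υs} : AppsPath S R a F υs →
      AppsPath S R (.app a (.rho .irr) .box) F (υs ++ [.tm (.rho .irr)])
  | capp {R a F υs} : AppsPath S R a F υs → AppsPath S R (.capp a) F (υs ++ [.co])

/-- `ApplyArgs a b b'`: applying `b` to the arguments of the path `a` gives `b'`. The branch of a
case expression is a function, so role annotations of arguments are replaced by `+`. -/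
inductive ApplyArgs : Tm → Tm → Tm → Prop
  | const {F b} : ApplyArgs (.const F) b b
  | tapp {a R c b b'} : ApplyArgs a b b' →
      ApplyArgs (.app a (.role R) c) b (.app b' (.rho .rel) c)
  | app {a c b b'} : ApplyArgs a b b' →
      ApplyArgs (.app a (.rho .rel) c) b (.app b' (.rho .rel) c)
  | iapp {a b b'} : ApplyArgs a b b' →
      ApplyArgs (.app a (.rho .irr) .box) b (.app b' (.rho .irr) .box)
  | capp {a b b'} : ApplyArgs a b b' → ApplyArgs (.capp a) b (.capp b')

/-- The roles of the relevant arguments in a list of flags; `+` counts as `nom`. -/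
def appRoles : List AnyFlag → List Role
  | [] => []
  | .tm (.role R) :: υs => R :: appRoles υs
  | .tm (.rho .rel) :: υs => .nom :: appRoles υs
  | .tm (.rho .irr) :: υs => appRoles υs
  | .co :: υs => appRoles υs

/-- The flags `υs` saturate the declared parameter roles of `F`. -/
inductive SatApp (S : Signature) : Const → List AnyFlag → Prop
  | absConst {F A υs} : (F, .cs A (appRoles υs)) ∈ S → SatApp S F υs
  | const {F A υs p R a} : (F, .ax A (appRoles υs) p R a) ∈ S → SatApp S F υs

/-- Primitive reduction `a →β_R b`. -/
inductive Beta (S : Signature) : Tm → Tm → Role → Prop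
  | appAbs {ρ v b R} : Value S R (.lam ρ v) → Beta S (.app (.lam ρ v) (.rho ρ) b) (v.inst b) R
  | cappCAbs {b R} : Beta S (.capp (.clam b)) b R
  | axiomStep {F A Rs p R₁ b a σ R} : (F, .ax A Rs p R₁ b) ∈ S → PatMatch a p σ → R₁.le R →
      Beta S a (b.subst σ) R
  | patternTrue {a F υs b₁ b₁' b₂ R} : SatApp S F υs → AppsPath S .nom a F υs →
      ApplyArgs a b₁ b₁' → Beta S (.case a F υs b₁ b₂) (.capp b₁') R
  | patternFalse {a F υs b₁ b₂ R} : SatApp S F υs → Value S .nom a → ¬ AppsPath S .nom a F υs →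
      Beta S (.case a F υs b₁ b₂) b₂ R

/-! ### Typing and definitional equality -/

/-- `BranchTyping υs a A b A₁ B C`: in a case analysis of `a : A` with result type `C`, where
`b : A₁` is the part of the pattern seen so far and `υs` are the flags of its remaining arguments,
`B` is the required type of the remaining branch. It abstracts over the remaining arguments and over
a nominal equality between the scrutinee and the complete pattern. -/
inductive BranchTyping : List AnyFlag → Tm → Tm → Tm → Tm → Tm → Tm → Prop
  | base {a A b C} : BranchTyping [] a A b A (.cpi a b A .nom C) C
  | piRole {R υs a A b A₁ B₁ B C} (L : Finset Name) :
      (∀ x ∉ L, BranchTyping υs a A (.app b (.role R) (.fvar x)) (B₁.opn x) (B.opn x) C) →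
      BranchTyping (.tm (.role R) :: υs) a A b (.pi .rel A₁ B₁) (.pi .rel A₁ B) C
  | piRel {υs a A b A₁ B₁ B C} (L : Finset Name) :
      (∀ x ∉ L, BranchTyping υs a A (.app b (.rho .rel) (.fvar x)) (B₁.opn x) (B.opn x) C) →
      BranchTyping (.tm (.rho .rel) :: υs) a A b (.pi .rel A₁ B₁) (.pi .rel A₁ B) C
  | piIrr {υs a A b A₁ B₁ B C} (L : Finset Name) :
      (∀ x ∉ L, BranchTyping υs a A (.app b (.rho .irr) .box) (B₁.opn x) (B.opn x) C) →
      BranchTyping (.tm (.rho .irr) :: υs) a A b (.pi .irr A₁ B₁) (.pi .irr A₁ B) C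
  | cpi {υs a A b a₁ a₂ A₁ R₁ B₁ B C} :
      BranchTyping υs a A (.capp b) B₁ B C →
      BranchTyping (.co :: υs) a A b (.cpi a₁ a₂ A₁ R₁ B₁) (.cpi a₁ a₂ A₁ R₁ B) C

/-- An irrelevantly bound variable must not occur in the body. -/
def RhoCheck : Relevance → Name → Tm → Prop
  | .rel, _, _ => True
  | .irr, x, b => x ∉ b.fv

mutual

/-- Context well-formedness `⊨ Γ`. -/
inductive Ctx (S : Signature) : Context → Prop
  | empty : Ctx S []
  | consTm {Γ x A} : Ctx S Γ → Typing S Γ A .star → x ∉ dom Γ → Ctx S ((x, .tm A) :: Γ)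
  | consCo {Γ c φ} : Ctx S Γ → PropWff S Γ φ → c ∉ dom Γ → Ctx S ((c, .co φ) :: Γ)

/-- Typing `Γ ⊨ a : A`. -/
inductive Typing (S : Signature) : Context → Tm → Tm → Prop
  | star {Γ} : Ctx S Γ → Typing S Γ .star .star
  | var {Γ x A} : Ctx S Γ → (x, .tm A) ∈ Γ → Typing S Γ (.fvar x) A
  | pi {Γ ρ A B} (L : Finset Name) :
      (∀ x ∉ L, Typing S ((x, .tm A) :: Γ) (B.opn x) .star) →
      Typing S Γ A .star →
      Typing S Γ (.pi ρ A B) .star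
  | abs {Γ ρ A a B} (L : Finset Name) :
      (∀ x ∉ L, Typing S ((x, .tm A) :: Γ) (a.opn x) (B.opn x)) →
      Typing S Γ A .star →
      (∀ x ∉ L, RhoCheck ρ x (a.opn x)) →
      Typing S Γ (.lam ρ a) (.pi ρ A B)
  | app {Γ a b A B} :
      Typing S Γ b (.pi .rel A B) → Typing S Γ a A →
      Typing S Γ (.app b (.rho .rel) a) (B.inst a)
  | tapp {Γ a b A B R Rs} :
      Typing S Γ b (.pi .rel A B) → Typing S Γ a A → Roles S b (R :: Rs) →
      Typing S Γ (.app b (.role R) a) (B.inst a)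
  | iapp {Γ a b A B} :
      Typing S Γ b (.pi .irr A B) → Typing S Γ a A →
      Typing S Γ (.app b (.rho .irr) .box) (B.inst a)
  | conv {Γ a A B} :
      Typing S Γ a A → DefEq S Γ (dom Γ) A B .star .rep → Typing S Γ B .star →
      Typing S Γ a B
  | cpi {Γ a b A R B} (L : Finset Name) :
      (∀ c ∉ L, Typing S ((c, .co ⟨a, b, A, R⟩) :: Γ) B .star) →
      PropWff S Γ ⟨a, b, A, R⟩ →
      Typing S Γ (.cpi a b A R B) .star
  | cabs {Γ a b A R d B} (L : Finset Name) :
      (∀ c ∉ L, Typing S ((c, .co ⟨a, b, A, R⟩) :: Γ) d B) →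
      PropWff S Γ ⟨a, b, A, R⟩ →
      Typing S Γ (.clam d) (.cpi a b A R B)
  | capp {Γ a b A R d B} :
      Typing S Γ d (.cpi a b A R B) → DefEq S Γ (dom Γ) a b A R →
      Typing S Γ (.capp d) B
  | const {Γ F A Rs} :
      Ctx S Γ → (F, .cs A Rs) ∈ S → Typing S [] A .star →
      Typing S Γ (.const F) A
  | fam {Γ F A Rs p R a} :
      Ctx S Γ → (F, .ax A Rs p R a) ∈ S → Typing S [] A .star →
      Typing S Γ (.const F) A
  | case {Γ a F υs b₁ b₂ A A₁ B C} :
      Typing S Γ a A → Typing S Γ (.const F) A₁ →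
      BranchTyping υs a A (.const F) A₁ B C → SatApp S F υs →
      Typing S Γ b₁ B → Typing S Γ b₂ C →
      Typing S Γ (.case a F υs b₁ b₂) C

/-- Proposition well-formedness `Γ ⊨ φ ok`. -/
inductive PropWff (S : Signature) : Context → Constraint → Prop
  | wff {Γ a b A R} :
      Typing S Γ a A → Typing S Γ b A → Typing S Γ A .star → PropWff S Γ ⟨a, b, A, R⟩

/-- Definitional equality of propositions `Γ; Δ ⊨ φ₁ ≡ φ₂`. -/
inductive Iso (S : Signature) : Context → Finset Name → Constraint → Constraint → Prop
  | propCong {Γ Δ a₁ a₂ b₁ b₂ A R} :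
      DefEq S Γ Δ a₁ a₂ A R → DefEq S Γ Δ b₁ b₂ A R →
      Iso S Γ Δ ⟨a₁, b₁, A, R⟩ ⟨a₂, b₂, A, R⟩
  | isoConv {Γ Δ a b A B R} :
      DefEq S Γ Δ A B .star .rep → PropWff S Γ ⟨a, b, A, R⟩ → PropWff S Γ ⟨a, b, B, R⟩ →
      Iso S Γ Δ ⟨a, b, A, R⟩ ⟨a, b, B, R⟩
  | cpiFst {Γ Δ a₁ b₁ A₁ R₁ B₁ a₂ b₂ A₂ R₂ B₂ R} :
      DefEq S Γ Δ (.cpi a₁ b₁ A₁ R₁ B₁) (.cpi a₂ b₂ A₂ R₂ B₂) .star R →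
      Iso S Γ Δ ⟨a₁, b₁, A₁, R₁⟩ ⟨a₂, b₂, A₂, R₂⟩

/-- Definitional equality of terms: `DefEq S Γ Δ a b A R` is `Γ; Δ ⊨ a ≡_R b : A`. -/
inductive DefEq (S : Signature) : Context → Finset Name → Tm → Tm → Tm → Role → Prop
  | assn {Γ Δ c a b A R} :
      Ctx S Γ → (c, .co ⟨a, b, A, R⟩) ∈ Γ → c ∈ Δ → DefEq S Γ Δ a b A R
  | refl {Γ Δ a A R} : Typing S Γ a A → DefEq S Γ Δ a a A R
  | symm {Γ Δ a b A R} : DefEq S Γ Δ b a A R → DefEq S Γ Δ a b A R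
  | trans {Γ Δ a b d A R} : DefEq S Γ Δ a d A R → DefEq S Γ Δ d b A R → DefEq S Γ Δ a b A R
  | sub {Γ Δ a b A R₁ R₂} : DefEq S Γ Δ a b A R₁ → R₁.le R₂ → DefEq S Γ Δ a b A R₂
  | beta {Γ Δ a b A R} :
      Typing S Γ a A → Typing S Γ b A → Beta S a b R → DefEq S Γ Δ a b A R
  | piCong {Γ Δ ρ A₁ B₁ A₂ B₂ R} (L : Finset Name) :
      DefEq S Γ Δ A₁ A₂ .star R →
      (∀ x ∉ L, DefEq S ((x, .tm A₁) :: Γ) Δ (B₁.opn x) (B₂.opn x) .star R) →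
      Typing S Γ A₁ .star → Typing S Γ (.pi ρ A₁ B₁) .star → Typing S Γ (.pi ρ A₂ B₂) .star →
      DefEq S Γ Δ (.pi ρ A₁ B₁) (.pi ρ A₂ B₂) .star R
  | absCong {Γ Δ ρ A b₁ b₂ B R} (L : Finset Name) :
      (∀ x ∉ L, DefEq S ((x, .tm A) :: Γ) Δ (b₁.opn x) (b₂.opn x) (B.opn x) R) →
      Typing S Γ A .star →
      (∀ x ∉ L, RhoCheck ρ x (b₁.opn x)) → (∀ x ∉ L, RhoCheck ρ x (b₂.opn x)) →
      DefEq S Γ Δ (.lam ρ b₁) (.lam ρ b₂) (.pi ρ A B) R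
  | appCong {Γ Δ a₁ a₂ b₁ b₂ A B R} :
      DefEq S Γ Δ a₁ b₁ (.pi .rel A B) R → DefEq S Γ Δ a₂ b₂ A .nom →
      DefEq S Γ Δ (.app a₁ (.rho .rel) a₂) (.app b₁ (.rho .rel) b₂) (B.inst a₂) R
  | tappCong {Γ Δ a₁ a₂ b₁ b₂ A B R R' Rs Rs'} :
      DefEq S Γ Δ a₁ b₁ (.pi .rel A B) R' → DefEq S Γ Δ a₂ b₂ A (R.meet R') →
      Roles S a₁ (R :: Rs) → Roles S b₁ (R :: Rs') →
      Typing S Γ (.app b₁ (.role R) b₂) (B.inst a₂) →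
      DefEq S Γ Δ (.app a₁ (.role R) a₂) (.app b₁ (.role R) b₂) (B.inst a₂) R'
  | iappCong {Γ Δ a₁ b₁ a A B R} :
      DefEq S Γ Δ a₁ b₁ (.pi .irr A B) R → Typing S Γ a A →
      DefEq S Γ Δ (.app a₁ (.rho .irr) .box) (.app b₁ (.rho .irr) .box) (B.inst a) R
  | piFst {Γ Δ ρ A₁ B₁ A₂ B₂ R} :
      DefEq S Γ Δ (.pi ρ A₁ B₁) (.pi ρ A₂ B₂) .star R → DefEq S Γ Δ A₁ A₂ .star R
  | piSnd {Γ Δ ρ A₁ B₁ A₂ B₂ a₁ a₂ R} :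
      DefEq S Γ Δ (.pi ρ A₁ B₁) (.pi ρ A₂ B₂) .star R → DefEq S Γ Δ a₁ a₂ A₁ .nom →
      DefEq S Γ Δ (B₁.inst a₁) (B₂.inst a₂) .star R
  | cpiCong {Γ Δ a₁ b₁ A₁ R₁ B₁ a₂ b₂ A₂ R₂ B₂ R} (L : Finset Name) :
      Iso S Γ Δ ⟨a₁, b₁, A₁, R₁⟩ ⟨a₂, b₂, A₂, R₂⟩ →
      (∀ c ∉ L, DefEq S ((c, .co ⟨a₁, b₁, A₁, R₁⟩) :: Γ) Δ B₁ B₂ .star R) →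
      PropWff S Γ ⟨a₁, b₁, A₁, R₁⟩ →
      Typing S Γ (.cpi a₁ b₁ A₁ R₁ B₁) .star → Typing S Γ (.cpi a₂ b₂ A₂ R₂ B₂) .star →
      DefEq S Γ Δ (.cpi a₁ b₁ A₁ R₁ B₁) (.cpi a₂ b₂ A₂ R₂ B₂) .star R
  | cabsCong {Γ Δ a b A R₁ d₁ d₂ B R} (L : Finset Name) :
      (∀ c ∉ L, DefEq S ((c, .co ⟨a, b, A, R₁⟩) :: Γ) Δ d₁ d₂ B R) →
      PropWff S Γ ⟨a, b, A, R₁⟩ →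
      DefEq S Γ Δ (.clam d₁) (.clam d₂) (.cpi a b A R₁ B) R
  | cappCong {Γ Δ d₁ d₂ a b A R₁ B R} :
      DefEq S Γ Δ d₁ d₂ (.cpi a b A R₁ B) R → DefEq S Γ (dom Γ) a b A R₁ →
      DefEq S Γ Δ (.capp d₁) (.capp d₂) B R
  | cpiSnd {Γ Δ a₁ b₁ A₁ R₁ B₁ a₂ b₂ A₂ R₂ B₂ R} :
      DefEq S Γ Δ (.cpi a₁ b₁ A₁ R₁ B₁) (.cpi a₂ b₂ A₂ R₂ B₂) .star R →
      DefEq S Γ (dom Γ) a₁ b₁ A₁ R₁ → DefEq S Γ (dom Γ) a₂ b₂ A₂ R₂ →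
      DefEq S Γ Δ B₁ B₂ .star R
  | cast {Γ Δ a b A R a' b' A' R'} :
      DefEq S Γ Δ a b A R → Iso S Γ Δ ⟨a, b, A, R⟩ ⟨a', b', A', R'⟩ →
      DefEq S Γ Δ a' b' A' R'
  | eqConv {Γ Δ a b A B R} :
      DefEq S Γ Δ a b A R → DefEq S Γ (dom Γ) A B .star .rep → DefEq S Γ Δ a b B R
  | isoSnd {Γ Δ a b A R a' b' A' R'} :
      Iso S Γ Δ ⟨a, b, A, R⟩ ⟨a', b', A', R'⟩ → DefEq S Γ Δ A A' .star .rep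
  | patCong {Γ Δ a a' F υs b₁ b₁' b₂ b₂' A A₁ B B' C R} :
      DefEq S Γ Δ a a' A .nom → Typing S Γ (.const F) A₁ →
      BranchTyping υs a A (.const F) A₁ B C → BranchTyping υs a' A (.const F) A₁ B' C →
      SatApp S F υs → DefEq S Γ (dom Γ) B B' .star .rep →
      DefEq S Γ Δ b₁ b₁' B R → DefEq S Γ Δ b₂ b₂' C R →
      DefEq S Γ Δ (.case a F υs b₁ b₂) (.case a' F υs b₁' b₂') C R
  | leftRel {Γ Δ a a' b b' A B F R₁ R₂} :
      CasePath S R₂ (.app a (.role R₁) b) F → CasePath S R₂ (.app a' (.role R₁) b') F →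
      Typing S Γ a (.pi .rel A B) → Typing S Γ b A →
      Typing S Γ a' (.pi .rel A B) → Typing S Γ b' A →
      DefEq S Γ Δ (.app a (.role R₁) b) (.app a' (.role R₁) b') (B.inst b) R₂ →
      DefEq S Γ (dom Γ) (B.inst b) (B.inst b') .star .rep →
      DefEq S Γ Δ a a' (.pi .rel A B) R₂
  | leftIrr {Γ Δ a a' b b' A B F R} :
      CasePath S R (.app a (.rho .irr) .box) F → CasePath S R (.app a' (.rho .irr) .box) F →
      Typing S Γ a (.pi .irr A B) → Typing S Γ b A →
      Typing S Γ a' (.pi .irr A B) → Typing S Γ b' A →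
      DefEq S Γ Δ (.app a (.rho .irr) .box) (.app a' (.rho .irr) .box) (B.inst b) R →
      DefEq S Γ (dom Γ) (B.inst b) (B.inst b') .star .rep →
      DefEq S Γ Δ a a' (.pi .irr A B) R
  | right {Γ Δ a a' b b' A B F R₁ R₂} :
      CasePath S R₂ (.app a (.role R₁) b) F → CasePath S R₂ (.app a' (.role R₁) b') F →
      Typing S Γ a (.pi .rel A B) → Typing S Γ b A →
      Typing S Γ a' (.pi .rel A B) → Typing S Γ b' A →
      DefEq S Γ Δ (.app a (.role R₁) b) (.app a' (.role R₁) b') (B.inst b) R₂ →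
      DefEq S Γ (dom Γ) (B.inst b) (B.inst b') .star .rep →
      DefEq S Γ Δ b b' A (R₁.meet R₂)
  | cLeft {Γ Δ d d' a b A R₁ B F R} :
      CasePath S R (.capp d) F → CasePath S R (.capp d') F →
      Typing S Γ d (.cpi a b A R₁ B) → Typing S Γ d' (.cpi a b A R₁ B) →
      DefEq S Γ (dom Γ) a b A R₁ →
      DefEq S Γ Δ (.capp d) (.capp d') B R →
      DefEq S Γ Δ d d' (.cpi a b A R₁ B) R

end

/-! ### Role-checking and signatures -/

/-- Role-checking contexts; the most recent entry comes first. -/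
abbrev RoleCtx := List (Name × Role)

/-- The role-checking judgment `Ω ⊨ a : R`. -/
inductive Roleing (S : Signature) : RoleCtx → Tm → Role → Prop
  | star {Ω R} : Roleing S Ω .star R
  | box {Ω R} : Roleing S Ω .box R
  | var {Ω x R R₁} : (x, R) ∈ Ω → R.le R₁ → Roleing S Ω (.fvar x) R₁
  | const {Ω F A Rs R} : (F, .cs A Rs) ∈ S → Roleing S Ω (.const F) R
  | fam {Ω F A Rs p R₁ a R} : (F, .ax A Rs p R₁ a) ∈ S → Roleing S Ω (.const F) R
  | abs {Ω ρ b R} (L : Finset Name) :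
      (∀ x ∉ L, Roleing S ((x, .nom) :: Ω) (b.opn x) R) → Roleing S Ω (.lam ρ b) R
  | app {Ω a ρ b R} : Roleing S Ω a R → Roleing S Ω b .nom → Roleing S Ω (.app a (.rho ρ) b) R
  | tapp {Ω a b R₁ Rs R} : Roleing S Ω a R → Roles S a (R₁ :: Rs) → Roleing S Ω b (R₁.meet R) →
      Roleing S Ω (.app a (.role R₁) b) R
  | pi {Ω ρ A B R} (L : Finset Name) : Roleing S Ω A R →
      (∀ x ∉ L, Roleing S ((x, .nom) :: Ω) (B.opn x) R) → Roleing S Ω (.pi ρ A B) R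
  | cpi {Ω a b A R₁ B R} : Roleing S Ω a R₁ → Roleing S Ω b R₁ → Roleing S Ω A R₁ →
      Roleing S Ω B R → Roleing S Ω (.cpi a b A R₁ B) R
  | cabs {Ω b R} : Roleing S Ω b R → Roleing S Ω (.clam b) R
  | capp {Ω a R} : Roleing S Ω a R → Roleing S Ω (.capp a) R
  | case {Ω a F υs b₁ b₂ R} : Roleing S Ω a .nom → Roleing S Ω b₁ R → Roleing S Ω b₂ R →
      Roleing S Ω (.case a F υs b₁ b₂) R

/-- `PatCtx F A p Γ B Ω`: the pattern `p`, headed by `F : A`, binds the variables of `Γ`, has type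
`B`, and gives the roles `Ω` to its relevant variables. -/
inductive PatCtx (F : Const) (A : Tm) : Pat → Context → Tm → RoleCtx → Prop
  | const : PatCtx F A (.const F) [] A []
  | piRole {p Γ A' B Ω R x} : PatCtx F A p Γ (.pi .rel A' B) Ω → x ∉ dom Γ →
      PatCtx F A (.appRole p R x) ((x, .tm A') :: Γ) (B.opn x) ((x, R) :: Ω)
  | piRel {p Γ A' B Ω x} : PatCtx F A p Γ (.pi .rel A' B) Ω → x ∉ dom Γ →
      PatCtx F A (.appRel p x) ((x, .tm A') :: Γ) (B.opn x) ((x, .nom) :: Ω)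
  | piIrr {p Γ A' B Ω x} : PatCtx F A p Γ (.pi .irr A' B) Ω → x ∉ dom Γ →
      PatCtx F A (.appIrr p) ((x, .tm A') :: Γ) (B.opn x) Ω
  | cpi {p Γ a b A' R B Ω c} : PatCtx F A p Γ (.cpi a b A' R B) Ω → c ∉ dom Γ →
      PatCtx F A (.capp p) ((c, .co ⟨a, b, A', R⟩) :: Γ) B Ω

/-- `SigOK S T`: every declaration of `T` is well-formed relative to the whole signature `S`. -/
inductive SigOK (S : Signature) : Signature → Prop
  | empty : SigOK S []
  | consConst {T F A Rs} : SigOK S T → F ∉ T.map Prod.fst → Typing S [] A .star →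
      SigOK S ((F, .cs A Rs) :: T)
  | consAx {T F A p R a Γ B Ω} : SigOK S T → F ∉ T.map Prod.fst → Typing S [] A .star →
      PatCtx F A p Γ B Ω → Typing S Γ a B → Roleing S Ω a R →
      SigOK S ((F, .ax A (Ω.map Prod.snd).reverse p R a) :: T)

/-- Signature well-formedness `⊨ Σ₀`; definitions may be mutually recursive. -/
def WfSignature (S : Signature) : Prop := SigOK S S

/-! ### Context equality -/

/-- Context equality `⊨ Γ₁ ≡ Γ₂`: the contexts bind the same variables in the same order, to types
that are representationally equal and to propositions that are equal. Equality is required in the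
prefix of the first context only. -/
inductive CtxEq (S : Signature) : Context → Context → Prop
  | empty : CtxEq S [] []
  | consTm {Γ₁ Γ₂ x A₁ A₂} : CtxEq S Γ₁ Γ₂ → DefEq S Γ₁ (dom Γ₁) A₁ A₂ .star .rep →
      CtxEq S ((x, .tm A₁) :: Γ₁) ((x, .tm A₂) :: Γ₂)
  | consCo {Γ₁ Γ₂ c φ₁ φ₂} : CtxEq S Γ₁ Γ₂ → Iso S Γ₁ (dom Γ₁) φ₁ φ₂ →
      CtxEq S ((c, .co φ₁) :: Γ₁) ((c, .co φ₂) :: Γ₂)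

end DR

/-!
Context conversion is an instance of the substitution lemma: two equal contexts are related by the
identity substitution. Accordingly a substitution from `Γ` to `Γ'` is taken in a general form
(`DR.Morphism`): it sends the variables of `Γ` to terms of the substituted types and its coercion
assumptions to *derivable* equalities, which need not be assumptions of `Γ'`. Substitution of a
term for a variable, discharging a coercion assumption, and context conversion are three cases of
it.

Going below a binder requires that morphisms can be weakened, so weakening comes first. Both results
come from a single mutual induction over the judgments, `DR.SubstFamily.typing` and its companions,
carried out for an arbitrary family of substitutions that is closed under binders
(`DR.SubstFamily`); weakenings and morphisms are two such families. The induction needs reduction to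
be stable under substitution (`DR.Beta.subst`). This is where well-formedness of the signature is
used: role-checking ensures that the right-hand side of an axiom has no free variables other than
those bound by its pattern (`DR.SigOK.fv_subset_vars`).

The substitution lemma gives regularity: types of typable terms are types
(`DR.Typing.type_typing`), and both sides of a derivable equality are well-formed
(`DR.DefEq.typing`, `DR.Iso.propWff`). Context equality compares entries in the first context only;
with regularity, induction on it shows that the second context is well-formed and that the identity
is a morphism to it (`DR.CtxEq.morphism`): a variable `x : A₁` of the first context gets its type
from `x : A₂` by conversion, and an assumption `c : φ₁` follows from `c : φ₂` by casting.
-/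

namespace DR

/-! ### Substitution and opening -/

/-- A term is locally closed if opening leaves it unchanged, at every index. -/
def Tm.LC (t : Tm) : Prop := ∀ (k : ℕ) (u : Tm), Tm.openRec u k t = t

/-- The single substitution `{u/x}`. -/
def single (x : Name) (u : Tm) : Name → Tm := Function.update Tm.fvar x u

/-- The extension of `σ` under a binder whose variable is named `x`. -/
def lift (σ : Name → Tm) (x : Name) : Name → Tm := Function.update σ x (.fvar x)

/-- Substitution in a proposition. -/
def Constraint.subst (σ : Name → Tm) (φ : Constraint) : Constraint :=
  ⟨φ.lhs.subst σ, φ.rhs.subst σ, φ.ty.subst σ, φ.R⟩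

theorem Tm.openRec_eq_of_openRec_openRec {u v t : Tm} {i j : ℕ} (hij : i ≠ j)
    (h : Tm.openRec u i (Tm.openRec v j t) = Tm.openRec v j t) : Tm.openRec u i t = t := by
  induction t generalizing i j with
  | bvar n =>
    by_cases hn : n = j
    · subst hn
      simp [Tm.openRec, Ne.symm hij]
    · simpa [Tm.openRec, hn] using h
  | lam ρ b ih =>
    simp only [Tm.openRec, Tm.lam.injEq, true_and] at h ⊢
    exact ih (by omega) h
  | app a ν b iha ihb =>
    simp only [Tm.openRec, Tm.app.injEq, true_and] at h ⊢
    exact ⟨iha hij h.1, ihb hij h.2⟩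
  | pi ρ A B iha ihb =>
    simp only [Tm.openRec, Tm.pi.injEq, true_and] at h ⊢
    exact ⟨iha hij h.1, ihb (by omega) h.2⟩
  | clam b ih =>
    simp only [Tm.openRec, Tm.clam.injEq] at h ⊢
    exact ih hij h
  | capp b ih =>
    simp only [Tm.openRec, Tm.capp.injEq] at h ⊢
    exact ih hij h
  | cpi a b A R B iha ihb ihA ihB =>
    simp only [Tm.openRec, Tm.cpi.injEq, true_and] at h ⊢
    exact ⟨iha hij h.1, ihb hij h.2.1, ihA hij h.2.2.1, ihB hij h.2.2.2⟩
  | case a F υs b₁ b₂ iha ih₁ ih₂ =>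
    simp only [Tm.openRec, Tm.case.injEq, true_and] at h ⊢
    exact ⟨iha hij h.1, ih₁ hij h.2.1, ih₂ hij h.2.2⟩
  | _ => rfl

theorem Tm.LC.fvar (x : Name) : (Tm.fvar x).LC := fun _ _ => rfl

theorem Tm.LC.openRec_succ_of_opn {b : Tm} {x : Name} (h : (b.opn x).LC) (k : ℕ) (u : Tm) :
    Tm.openRec u (k + 1) b = b :=
  Tm.openRec_eq_of_openRec_openRec (Nat.succ_ne_zero k) (h (k + 1) u)

theorem Tm.subst_openRec {σ : Name → Tm} (hσ : ∀ x, (σ x).LC) (u t : Tm) (k : ℕ) :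
    (Tm.openRec u k t).subst σ = Tm.openRec (u.subst σ) k (t.subst σ) := by
  induction t generalizing k with
  | bvar n => by_cases hn : n = k <;> simp [Tm.openRec, Tm.subst, hn]
  | fvar x => simp [Tm.openRec, Tm.subst, hσ x k]
  | _ => simp_all [Tm.openRec, Tm.subst]

theorem Tm.subst_inst {σ : Name → Tm} (hσ : ∀ x, (σ x).LC) (B u : Tm) :
    (B.inst u).subst σ = (B.subst σ).inst (u.subst σ) :=
  Tm.subst_openRec hσ u B 0

theorem Tm.subst_congr {σ τ : Name → Tm} {t : Tm} (h : ∀ x ∈ t.fv, σ x = τ x) :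
    t.subst σ = t.subst τ := by
  induction t with
  | fvar x => exact h x (by simp [Tm.fv])
  | _ => simp_all [Tm.fv, Tm.subst]

theorem Tm.subst_fvar (t : Tm) : t.subst Tm.fvar = t := by
  induction t <;> simp_all [Tm.subst]

theorem Tm.subst_subst (σ τ : Name → Tm) (t : Tm) :
    (t.subst τ).subst σ = t.subst fun x => (τ x).subst σ := by
  induction t <;> simp_all [Tm.subst]

theorem Tm.subst_eq_self_of_fv_eq_empty {t : Tm} (h : t.fv = ∅) (σ : Name → Tm) :
    t.subst σ = t := by
  rw [Tm.subst_congr (τ := Tm.fvar) (by simp [h]), Tm.subst_fvar]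

theorem Tm.fv_subset_fv_openRec (u t : Tm) (k : ℕ) : t.fv ⊆ (Tm.openRec u k t).fv := by
  induction t generalizing k with
  | bvar n => simp [Tm.fv]
  | _ =>
    simp only [Tm.openRec, Tm.fv]
    first | exact subset_rfl | gcongr <;> apply_assumption | apply_assumption

theorem Tm.fv_openRec_subset (u t : Tm) (k : ℕ) : (Tm.openRec u k t).fv ⊆ t.fv ∪ u.fv := by
  intro y
  induction t generalizing k with
  | bvar n => by_cases hn : n = k <;> simp [Tm.openRec, Tm.fv, hn]
  | _ =>
    simp only [Tm.openRec, Tm.fv, Finset.mem_union] at *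
    grind

theorem Tm.mem_fv_subst {σ : Name → Tm} {t : Tm} {y : Name} :
    y ∈ (t.subst σ).fv ↔ ∃ z ∈ t.fv, y ∈ (σ z).fv := by
  induction t with
  | fvar x => simp [Tm.subst, Tm.fv]
  | _ =>
    simp only [Tm.subst, Tm.fv, Finset.mem_union, Finset.notMem_empty] at *
    grind

theorem Tm.fv_subset_fv_opn (t : Tm) (x : Name) : t.fv ⊆ (t.opn x).fv :=
  Tm.fv_subset_fv_openRec _ _ _

theorem Tm.mem_fv_of_mem_fv_opn {t : Tm} {x y : Name} (h : y ∈ (t.opn x).fv) (hne : y ≠ x) :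
    y ∈ t.fv := by
  have := Tm.fv_openRec_subset _ _ _ h
  simpa [Tm.fv, hne] using this

theorem lift_lc {σ : Name → Tm} (hσ : ∀ x, (σ x).LC) (x : Name) : ∀ y, (lift σ x y).LC := by
  intro y
  by_cases h : y = x
  · subst h
    simpa [lift] using Tm.LC.fvar y
  · simpa [lift, h] using hσ y

theorem lift_self (σ : Name → Tm) (x : Name) : lift σ x x = .fvar x := by simp [lift]

theorem lift_of_ne (σ : Name → Tm) {x y : Name} (h : y ≠ x) : lift σ x y = σ y := by
  simp [lift, h]

theorem lift_fvar (x : Name) : lift Tm.fvar x = Tm.fvar := by simp [lift]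

theorem Tm.subst_lift {σ : Name → Tm} {t : Tm} {x : Name} (hx : x ∉ t.fv) :
    t.subst (lift σ x) = t.subst σ :=
  Tm.subst_congr fun _ hy => lift_of_ne σ fun h => hx (h ▸ hy)

theorem Tm.subst_lift_opn {σ : Name → Tm} (hσ : ∀ x, (σ x).LC) {t : Tm} {x : Name}
    (hx : x ∉ t.fv) : (t.opn x).subst (lift σ x) = (t.subst σ).opn x := by
  unfold Tm.opn
  rw [Tm.subst_inst (lift_lc hσ x), Tm.subst_lift hx]
  simp [Tm.subst, lift_self]

theorem single_lc {u : Tm} (hu : u.LC) (x : Name) : ∀ y, (single x u y).LC := by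
  intro y
  by_cases h : y = x
  · subst h
    simpa [single] using hu
  · simpa [single, h] using Tm.LC.fvar y

theorem single_self (x : Name) (u : Tm) : single x u x = u := by simp [single]

theorem single_of_ne {x y : Name} (h : y ≠ x) (u : Tm) : single x u y = .fvar y := by
  simp [single, h]

theorem Tm.subst_single {t : Tm} {x : Name} (hx : x ∉ t.fv) (u : Tm) :
    t.subst (single x u) = t := by
  have h : t.subst (single x u) = t.subst Tm.fvar :=
    Tm.subst_congr fun y hy => single_of_ne (by rintro rfl; exact hx hy) u
  rw [h, Tm.subst_fvar]

theorem Tm.subst_single_opn {t u : Tm} {x : Name} (hu : u.LC) (hx : x ∉ t.fv) :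
    (t.opn x).subst (single x u) = t.inst u := by
  unfold Tm.opn
  rw [Tm.subst_inst (single_lc hu x), Tm.subst_single hx]
  simp [Tm.subst, single_self]

/-- Substitution preserves the condition on irrelevantly bound variables. -/
theorem RhoCheck.subst {σ : Name → Tm} (hσ : ∀ x, (σ x).LC) {ρ : Relevance} {x : Name} {b : Tm}
    (h : RhoCheck ρ x (b.opn x)) (hx : x ∉ b.fv) (hx' : x ∉ (b.subst σ).fv) :
    RhoCheck ρ x ((b.subst σ).opn x) := by
  cases ρ with
  | rel => trivial
  | irr =>
    change x ∉ ((b.subst σ).opn x).fv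
    rw [← Tm.subst_lift_opn hσ hx, Tm.mem_fv_subst]
    rintro ⟨z, hz, hxz⟩
    have hne : z ≠ x := fun e => h (e ▸ hz)
    rw [lift_of_ne σ hne] at hxz
    exact hx' (Tm.mem_fv_subst.2 ⟨z, Tm.mem_fv_of_mem_fv_opn hz hne, hxz⟩)

theorem exists_name_notMem (L : Finset Name) : ∃ x, x ∉ L := Infinite.exists_notMem_finset L

/-! ### Stability of paths, values and reduction under substitution -/

theorem Roles.subst {S : Signature} {a : Tm} {Rs : List Role} (h : Roles S a Rs)
    (σ : Name → Tm) : Roles S (a.subst σ) Rs := by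
  induction h with
  | absConst h => exact .absConst h
  | const h => exact .const h
  | tapp _ ih => exact .tapp ih
  | app _ ih => exact .app ih
  | iapp _ ih => exact .iapp ih
  | capp _ ih => exact .capp ih

theorem Head.subst {S : Signature} {a : Tm} {F : Const} (h : Head S a F) (σ : Name → Tm) :
    Head S (a.subst σ) F := by
  induction h with
  | absConst h => exact .absConst h
  | const h => exact .const h
  | tapp _ ih => exact .tapp ih
  | app _ ih => exact .app ih
  | iapp _ ih => exact .iapp ih
  | capp _ ih => exact .capp ih

/-- The variables that a pattern binds. Irrelevant arguments bind none. -/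
def Pat.vars : Pat → Finset Name
  | .const _ => ∅
  | .appRole p _ x => insert x p.vars
  | .appRel p x => insert x p.vars
  | .appIrr p => p.vars
  | .capp p => p.vars

theorem PatMatch.subst {a : Tm} {p : Pat} {τ : Name → Tm} (h : PatMatch a p τ) (σ : Name → Tm) :
    ∃ τ', PatMatch (a.subst σ) p τ' ∧ ∀ x ∈ p.vars, τ' x = (τ x).subst σ := by
  induction h with
  | const => exact ⟨_, .const, by simp [Pat.vars]⟩
  | appRole _ ih =>
    obtain ⟨τ', h, hτ⟩ := ih
    refine ⟨_, .appRole h, fun y hy => ?_⟩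
    simp only [Pat.vars, Finset.mem_insert] at hy
    grind
  | appRel _ ih =>
    obtain ⟨τ', h, hτ⟩ := ih
    refine ⟨_, .appRel h, fun y hy => ?_⟩
    simp only [Pat.vars, Finset.mem_insert] at hy
    grind
  | appIrr _ ih =>
    obtain ⟨τ', h, hτ⟩ := ih
    exact ⟨_, .appIrr h, hτ⟩
  | capp _ ih =>
    obtain ⟨τ', h, hτ⟩ := ih
    exact ⟨_, .capp h, hτ⟩

/-- A path keeps its shape under substitution, so it matches no more patterns than before. -/
theorem Head.patMatch_of_subst {S : Signature} {a : Tm} {F : Const} {σ τ : Name → Tm} {p : Pat}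
    (h : Head S a F) (hm : PatMatch (a.subst σ) p τ) : ∃ τ', PatMatch a p τ' := by
  induction h generalizing p τ with
  | absConst _ | const _ => exact ⟨_, hm⟩
  | tapp _ ih =>
    cases hm with | appRole hm =>
    obtain ⟨_, h⟩ := ih hm
    exact ⟨_, .appRole h⟩
  | app _ ih =>
    cases hm with | appRel hm =>
    obtain ⟨_, h⟩ := ih hm
    exact ⟨_, .appRel h⟩
  | iapp _ ih =>
    cases hm with | appIrr hm =>
    obtain ⟨_, h⟩ := ih hm
    exact ⟨_, .appIrr h⟩
  | capp _ ih =>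
    cases hm with | capp hm =>
    obtain ⟨_, h⟩ := ih hm
    exact ⟨_, .capp h⟩

theorem Head.prefixMatch_of_subst {S : Signature} {a : Tm} {F : Const} {σ : Name → Tm} {p : Pat}
    (h : Head S a F) (hm : PrefixMatch (a.subst σ) p) : PrefixMatch a p := by
  induction h with
  | absConst _ | const _ => exact hm
  | @tapp a b R F h ih =>
    cases hm with
    | base hm => exact .base (Head.patMatch_of_subst (.tapp h) hm).choose_spec
    | app hm => exact .app (ih hm)
  | @app a b F h ih =>
    cases hm with
    | base hm => exact .base (Head.patMatch_of_subst (.app h) hm).choose_spec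
    | app hm => exact .app (ih hm)
  | iapp h ih =>
    cases hm with
    | base hm => exact .base (Head.patMatch_of_subst (.iapp h) hm).choose_spec
    | app hm => exact .app (ih hm)
  | capp h ih =>
    cases hm with
    | base hm => exact .base (Head.patMatch_of_subst (.capp h) hm).choose_spec
    | capp hm => exact .capp (ih hm)

theorem CasePath.head {S : Signature} {R : Role} {a : Tm} {F : Const} :
    CasePath S R a F → Head S a F
  | .absConst h _ => h
  | .const h _ _ => h
  | .unMatch h _ _ => h

theorem CasePath.subst {S : Signature} {R : Role} {a : Tm} {F : Const} (h : CasePath S R a F)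
    (σ : Name → Tm) : CasePath S R (a.subst σ) F := by
  cases h with
  | absConst h hF => exact .absConst (h.subst σ) hF
  | const h hF hR => exact .const (h.subst σ) hF hR
  | unMatch h hF hp => exact .unMatch (h.subst σ) hF fun hm => hp (h.prefixMatch_of_subst hm)

theorem Value.subst {S : Signature} {R : Role} {a : Tm} (h : Value S R a) {σ : Name → Tm}
    (hσ : ∀ x, (σ x).LC) : Value S R (a.subst σ) := by
  induction h generalizing σ with
  | star => exact .star
  | pi => exact .pi
  | cpi => exact .cpi
  | lamRel => exact .lamRel
  | @lamIrr b L _ ih =>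
    refine .lamIrr (L ∪ b.fv) fun x hx => ?_
    rw [Finset.notMem_union] at hx
    rw [← Tm.subst_lift_opn hσ hx.2]
    exact ih x hx.1 (lift_lc hσ x)
  | clam => exact .clam
  | path h => exact .path (h.subst σ)

theorem AppsPath.subst {S : Signature} {R : Role} {a : Tm} {F : Const} {υs : List AnyFlag}
    (h : AppsPath S R a F υs) (σ : Name → Tm) : AppsPath S R (a.subst σ) F υs := by
  induction h with
  | absConst h => exact .absConst h
  | const h hR => exact .const h hR
  | tapp _ ih => exact .tapp ih
  | app _ ih => exact .app ih
  | iapp _ ih => exact .iapp ih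
  | capp _ ih => exact .capp ih

theorem Head.appsPath_of_subst {S : Signature} {R : Role} {a : Tm} {F G : Const}
    {υs : List AnyFlag} {σ : Name → Tm} (h : Head S a G) (ha : AppsPath S R (a.subst σ) F υs) :
    AppsPath S R a F υs := by
  induction h generalizing υs with
  | absConst _ | const _ => exact ha
  | tapp _ ih => cases ha with | tapp ha => exact .tapp (ih ha)
  | app _ ih => cases ha with | app ha => exact .app (ih ha)
  | iapp _ ih => cases ha with | iapp ha => exact .iapp (ih ha)
  | capp _ ih => cases ha with | capp ha => exact .capp (ih ha)

/-- Substitution cannot turn a value into a path that a case expression selects. -/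
theorem Value.appsPath_of_subst {S : Signature} {R R' : Role} {a : Tm} {F : Const}
    {υs : List AnyFlag} {σ : Name → Tm} (h : Value S R a) (ha : AppsPath S R' (a.subst σ) F υs) :
    AppsPath S R' a F υs := by
  cases h with
  | path h => exact h.head.appsPath_of_subst ha
  | _ => cases ha

theorem ApplyArgs.subst {a b b' : Tm} (h : ApplyArgs a b b') (σ : Name → Tm) :
    ApplyArgs (a.subst σ) (b.subst σ) (b'.subst σ) := by
  induction h with
  | const => exact .const
  | tapp _ ih => exact .tapp ih
  | app _ ih => exact .app ih
  | iapp _ ih => exact .iapp ih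
  | capp _ ih => exact .capp ih

theorem BranchTyping.subst {υs : List AnyFlag} {a A b A₁ B C : Tm}
    (h : BranchTyping υs a A b A₁ B C) {σ : Name → Tm} (hσ : ∀ x, (σ x).LC) :
    BranchTyping υs (a.subst σ) (A.subst σ) (b.subst σ) (A₁.subst σ) (B.subst σ) (C.subst σ) := by
  induction h generalizing σ with
  | base => exact .base
  | @piRole R υs a A b A₁ B₁ B C L _ ih =>
    refine .piRole (L ∪ a.fv ∪ A.fv ∪ b.fv ∪ B₁.fv ∪ B.fv ∪ C.fv) fun x hx => ?_
    simp only [Finset.notMem_union] at hx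
    obtain ⟨⟨⟨⟨⟨⟨hL, ha⟩, hA⟩, hb⟩, hB₁⟩, hB⟩, hC⟩ := hx
    simpa only [Tm.subst, Tm.subst_lift, Tm.subst_lift_opn hσ, lift_self, ha, hA, hb, hB₁, hB, hC,
      not_false_eq_true] using ih x hL (lift_lc hσ x)
  | @piRel υs a A b A₁ B₁ B C L _ ih =>
    refine .piRel (L ∪ a.fv ∪ A.fv ∪ b.fv ∪ B₁.fv ∪ B.fv ∪ C.fv) fun x hx => ?_
    simp only [Finset.notMem_union] at hx
    obtain ⟨⟨⟨⟨⟨⟨hL, ha⟩, hA⟩, hb⟩, hB₁⟩, hB⟩, hC⟩ := hx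
    simpa only [Tm.subst, Tm.subst_lift, Tm.subst_lift_opn hσ, lift_self, ha, hA, hb, hB₁, hB, hC,
      not_false_eq_true] using ih x hL (lift_lc hσ x)
  | @piIrr υs a A b A₁ B₁ B C L _ ih =>
    refine .piIrr (L ∪ a.fv ∪ A.fv ∪ b.fv ∪ B₁.fv ∪ B.fv ∪ C.fv) fun x hx => ?_
    simp only [Finset.notMem_union] at hx
    obtain ⟨⟨⟨⟨⟨⟨hL, ha⟩, hA⟩, hb⟩, hB₁⟩, hB⟩, hC⟩ := hx
    simpa only [Tm.subst, Tm.subst_lift, Tm.subst_lift_opn hσ, lift_self, ha, hA, hb, hB₁, hB, hC,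
      not_false_eq_true] using ih x hL (lift_lc hσ x)
  | cpi _ ih => exact .cpi (ih hσ)

/-! ### Free variables of axioms -/

theorem Roleing.mem_of_mem_fv {S : Signature} {Ω : RoleCtx} {a : Tm} {R : Role}
    (h : Roleing S Ω a R) : ∀ y ∈ a.fv, y ∈ Ω.map Prod.fst := by
  induction h with
  | var h => simpa [Tm.fv] using ⟨_, h⟩
  | @abs Ω ρ b R L _ ih =>
    intro y hy
    obtain ⟨x, hx⟩ := exists_name_notMem (L ∪ {y})
    have := ih x (by grind) y (Tm.fv_subset_fv_opn b x hy)
    simp only [List.map_cons, List.mem_cons] at this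
    grind
  | @pi Ω ρ A B R L _ _ ihA ih =>
    intro y hy
    rcases Finset.mem_union.1 hy with hy | hy
    · exact ihA y hy
    obtain ⟨x, hx⟩ := exists_name_notMem (L ∪ {y})
    have := ih x (by grind) y (Tm.fv_subset_fv_opn B x hy)
    simp only [List.map_cons, List.mem_cons] at this
    grind
  | _ =>
    simp only [Tm.fv, Finset.mem_union, Finset.notMem_empty] at *
    grind

theorem PatCtx.mem_vars {F : Const} {A : Tm} {p : Pat} {Γ : Context} {B : Tm} {Ω : RoleCtx}
    (h : PatCtx F A p Γ B Ω) : ∀ y ∈ Ω.map Prod.fst, y ∈ p.vars := by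
  induction h with
  | _ =>
    simp only [Pat.vars, Finset.mem_insert, List.map_cons, List.mem_cons, List.map_nil] at *
    grind

/-- Role-checking confines the free variables of the right-hand side of an axiom to those that its
pattern binds to relevant arguments, although the typing context of that right-hand side also
contains the irrelevant ones. -/
theorem SigOK.fv_subset_vars {S T : Signature} (h : SigOK S T) {F : Const} {A : Tm}
    {Rs : List Role} {p : Pat} {R : Role} {a : Tm} (hF : (F, Decl.ax A Rs p R a) ∈ T) :
    a.fv ⊆ p.vars := by
  induction h with
  | empty => simp at hF
  | consConst _ _ _ ih =>
    simp only [List.mem_cons, Prod.mk.injEq, reduceCtorEq, and_false, false_or] at hF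
    exact ih hF
  | consAx _ _ _ hp _ hr ih =>
    rcases List.mem_cons.1 hF with hF | hF
    · simp only [Prod.mk.injEq, Decl.ax.injEq] at hF
      obtain ⟨_, _, _, rfl, _, rfl⟩ := hF
      exact fun y hy => hp.mem_vars y (hr.mem_of_mem_fv y hy)
    · exact ih hF

/-- Well-formedness of the signature is essential: if the right-hand side of an axiom had a free
variable that its pattern does not bind, then `σ` would replace it in the reduct of `a`, but it
would stay free in the reduct of `a.subst σ`. -/
theorem Beta.subst {S : Signature} (hS : WfSignature S) {a b : Tm} {R : Role} (h : Beta S a b R)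
    {σ : Name → Tm} (hσ : ∀ x, (σ x).LC) : Beta S (a.subst σ) (b.subst σ) R := by
  cases h with
  | appAbs h =>
    rw [Tm.subst_inst hσ]
    exact .appAbs (h.subst hσ)
  | cappCAbs => exact .cappCAbs
  | axiomStep hF hm hR =>
    obtain ⟨τ', hm', hτ⟩ := hm.subst σ
    rw [Tm.subst_subst, Tm.subst_congr (τ := τ') fun x hx =>
      (hτ x (SigOK.fv_subset_vars hS hF hx)).symm]
    exact .axiomStep hF hm' hR
  | patternTrue hs ha hb => exact .patternTrue hs (ha.subst σ) (hb.subst σ)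
  | patternFalse hs hv ha =>
    exact .patternFalse hs (hv.subst hσ) fun h => ha (hv.appsPath_of_subst h)

/-! ### Contexts, free variables and local closure of typed terms -/

theorem mem_dom_of_mem {Γ : Context} {x : Name} {e : Entry} (h : (x, e) ∈ Γ) : x ∈ dom Γ :=
  List.mem_toFinset.2 (List.mem_map_of_mem h)

theorem dom_cons (x : Name) (e : Entry) (Γ : Context) : dom ((x, e) :: Γ) = insert x (dom Γ) := by
  simp [dom]

mutual

theorem Typing.ctx {S Γ a A} : Typing S Γ a A → Ctx S Γ
  | .star h => h
  | .var h _ => h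
  | .pi _ _ h => h.ctx
  | .abs _ _ h _ => h.ctx
  | .app h _ => h.ctx
  | .tapp h _ _ => h.ctx
  | .iapp h _ => h.ctx
  | .conv h _ _ => h.ctx
  | .cpi _ _ h => h.ctx
  | .cabs _ _ h => h.ctx
  | .capp h _ => h.ctx
  | .const h _ _ => h
  | .fam h _ _ => h
  | .case h _ _ _ _ _ => h.ctx

theorem PropWff.ctx {S Γ φ} : PropWff S Γ φ → Ctx S Γ
  | .wff h _ _ => h.ctx

end

theorem fv_subset_dom_of_cofinite {b : Tm} {L D : Finset Name}
    (h : ∀ x ∉ L, (b.opn x).fv ⊆ insert x D) : b.fv ⊆ D := by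
  intro y hy
  obtain ⟨x, hx⟩ := exists_name_notMem (L ∪ {y})
  have := h x (by grind) (Tm.fv_subset_fv_opn b x hy)
  grind

mutual

/-- Only the subject of the judgment is considered, not its type, so that the induction does not
involve definitional equality. -/
theorem Typing.fv_subset {S Γ a A} : Typing S Γ a A → a.fv ⊆ dom Γ
  | .star _ => by simp [Tm.fv]
  | .var _ h => by simpa [Tm.fv] using mem_dom_of_mem h
  | .pi L h h' => Finset.union_subset h'.fv_subset
      (fv_subset_dom_of_cofinite fun x hx => dom_cons x _ _ ▸ (h x hx).fv_subset)
  | .abs (a := a) L h _ _ =>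
    fv_subset_dom_of_cofinite (b := a) fun x hx => dom_cons x _ _ ▸ (h x hx).fv_subset
  | .app h h' => Finset.union_subset h.fv_subset h'.fv_subset
  | .tapp h h' _ => Finset.union_subset h.fv_subset h'.fv_subset
  | .iapp h _ => Finset.union_subset h.fv_subset (Finset.empty_subset _)
  | .conv h _ _ => h.fv_subset
  | .cpi L h h' => by
    obtain ⟨ha, hb, hA⟩ := h'.fv_subset
    refine Finset.union_subset (Finset.union_subset (Finset.union_subset ha hb) hA) fun y hy => ?_
    obtain ⟨c, hc⟩ := exists_name_notMem (L ∪ {y})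
    have := dom_cons c _ _ ▸ (h c (by grind)).fv_subset hy
    grind
  | .cabs L h _ => by
    intro y hy
    obtain ⟨c, hc⟩ := exists_name_notMem (L ∪ {y})
    have := dom_cons c _ _ ▸ (h c (by grind)).fv_subset hy
    grind
  | .capp h _ => h.fv_subset
  | .const _ _ _ => by simp [Tm.fv]
  | .fam _ _ _ => by simp [Tm.fv]
  | .case h _ _ _ h₁ h₂ => Finset.union_subset (Finset.union_subset h.fv_subset h₁.fv_subset)
      h₂.fv_subset

theorem PropWff.fv_subset {S Γ φ} : PropWff S Γ φ →
    φ.lhs.fv ⊆ dom Γ ∧ φ.rhs.fv ⊆ dom Γ ∧ φ.ty.fv ⊆ dom Γ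
  | .wff ha hb hA => ⟨ha.fv_subset, hb.fv_subset, hA.fv_subset⟩

end

theorem Typing.subst_eq_self {S : Signature} {a A : Tm} (h : Typing S [] a A) (σ : Name → Tm) :
    a.subst σ = a :=
  Tm.subst_eq_self_of_fv_eq_empty (Finset.subset_empty.1 h.fv_subset) σ

theorem Tm.LC.openRec_succ_of_cofinite {b : Tm} {L : Finset Name} (h : ∀ x ∉ L, (b.opn x).LC)
    (k : ℕ) (u : Tm) : Tm.openRec u (k + 1) b = b :=
  have ⟨x, hx⟩ := exists_name_notMem L
  (h x hx).openRec_succ_of_opn k u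

mutual

theorem Typing.lc {S Γ a A} : Typing S Γ a A → a.LC
  | .star _ => fun _ _ => rfl
  | .var _ _ => fun _ _ => rfl
  | .pi L h h' => fun k u => congrArg₂ _ (h'.lc k u)
      (Tm.LC.openRec_succ_of_cofinite (fun x hx => (h x hx).lc) k u)
  | .abs L h _ _ => fun k u => congrArg _
      (Tm.LC.openRec_succ_of_cofinite (fun x hx => (h x hx).lc) k u)
  | .app h h' => fun k u => congrArg₂ (Tm.app · _ ·) (h.lc k u) (h'.lc k u)
  | .tapp h h' _ => fun k u => congrArg₂ (Tm.app · _ ·) (h.lc k u) (h'.lc k u)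
  | .iapp h _ => fun k u => congrArg (Tm.app · _ _) (h.lc k u)
  | .conv h _ _ => h.lc
  | .cpi L h h' => fun k u => by
    obtain ⟨ha, hb, hA⟩ := h'.lc
    obtain ⟨c, hc⟩ := exists_name_notMem L
    simp only [Tm.openRec, (h c hc).lc k u]
    rw [ha k u, hb k u, hA k u]
  | .cabs L h _ => fun k u => by
    obtain ⟨c, hc⟩ := exists_name_notMem L
    simp only [Tm.openRec, (h c hc).lc k u]
  | .capp h _ => fun k u => congrArg _ (h.lc k u)
  | .const _ _ _ => fun _ _ => rfl
  | .fam _ _ _ => fun _ _ => rfl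
  | .case h _ _ _ h₁ h₂ => fun k u => by
    simp only [Tm.openRec, h.lc k u, h₁.lc k u, h₂.lc k u]

theorem PropWff.lc {S Γ φ} : PropWff S Γ φ → φ.lhs.LC ∧ φ.rhs.LC ∧ φ.ty.LC
  | .wff ha hb hA => ⟨ha.lc, hb.lc, hA.lc⟩

end

/-! ### Stability of the judgments under families of substitutions -/

/-- A family `K Γ Δ σ Γ' Δ'` of substitutions from `Γ` (with available coercions `Δ`) to `Γ'` (with
available coercions `Δ'`) along which all judgments are stable: variables are sent to terms of the
substituted type, available coercion assumptions hold after substitution, and the family is closed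
under making all coercions available and under going below a binder whose variable is fresh. -/
structure SubstFamily (S : Signature)
    (K : Context → Finset Name → (Name → Tm) → Context → Finset Name → Prop) : Prop where
  lc {Γ Δ σ Γ' Δ'} : K Γ Δ σ Γ' Δ' → ∀ x, (σ x).LC
  ctx {Γ Δ σ Γ' Δ'} : K Γ Δ σ Γ' Δ' → Ctx S Γ'
  full {Γ Δ σ Γ' Δ'} : K Γ Δ σ Γ' Δ' → K Γ (dom Γ) σ Γ' (dom Γ')
  var {Γ Δ σ Γ' Δ' x A} : K Γ Δ σ Γ' Δ' → (x, .tm A) ∈ Γ → Typing S Γ' (σ x) (A.subst σ)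
  co {Γ Δ σ Γ' Δ' c a b A R} : K Γ Δ σ Γ' Δ' → (c, .co ⟨a, b, A, R⟩) ∈ Γ → c ∈ Δ →
    DefEq S Γ' Δ' (a.subst σ) (b.subst σ) (A.subst σ) R
  extTm {Γ Δ σ Γ' Δ' A} : K Γ Δ σ Γ' Δ' → Typing S Γ' (A.subst σ) .star →
    ∃ L : Finset Name, ∀ x ∉ L,
      K ((x, .tm A) :: Γ) Δ (lift σ x) ((x, .tm (A.subst σ)) :: Γ') Δ'
  extCo {Γ Δ σ Γ' Δ' φ} : K Γ Δ σ Γ' Δ' → PropWff S Γ' (φ.subst σ) →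
    ∃ L : Finset Name, ∀ c ∉ L,
      K ((c, .co φ) :: Γ) Δ σ ((c, .co (φ.subst σ)) :: Γ') Δ'

mutual

/-- Stability of typing under substitution, proved together with that of the other judgments. -/
theorem SubstFamily.typing {S : Signature} (hS : WfSignature S)
    {K : Context → Finset Name → (Name → Tm) → Context → Finset Name → Prop}
    (hK : SubstFamily S K) {Γ a A} (h : Typing S Γ a A) {Δ σ Γ' Δ'} (k : K Γ Δ σ Γ' Δ') :
    Typing S Γ' (a.subst σ) (A.subst σ) := by
  match h with
  | .star _ => exact .star (hK.ctx k)
  | .var _ h => exact hK.var k h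
  | .pi (B := B) L h hA =>
    have hA' := hK.typing hS hA k
    obtain ⟨M, hM⟩ := hK.extTm k hA'
    refine .pi (L ∪ M ∪ B.fv) (fun x hx => ?_) hA'
    simp only [Finset.notMem_union] at hx
    rw [← Tm.subst_lift_opn (hK.lc k) hx.2]
    exact hK.typing hS (h x hx.1.1) (hM x hx.1.2)
  | .abs (a := a) (B := B) L h hA hρ =>
    have hA' := hK.typing hS hA k
    obtain ⟨M, hM⟩ := hK.extTm k hA'
    refine .abs (L ∪ M ∪ a.fv ∪ B.fv ∪ (a.subst σ).fv) (fun x hx => ?_) hA' (fun x hx => ?_)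
    · simp only [Finset.notMem_union] at hx
      rw [← Tm.subst_lift_opn (hK.lc k) hx.1.1.2, ← Tm.subst_lift_opn (hK.lc k) hx.1.2]
      exact hK.typing hS (h x hx.1.1.1.1) (hM x hx.1.1.1.2)
    · simp only [Finset.notMem_union] at hx
      exact (hρ x hx.1.1.1.1).subst (hK.lc k) hx.1.1.2 hx.2
  | .app hb ha =>
    rw [Tm.subst_inst (hK.lc k)]
    exact .app (hK.typing hS hb k) (hK.typing hS ha k)
  | .tapp hb ha hr =>
    rw [Tm.subst_inst (hK.lc k)]
    exact .tapp (hK.typing hS hb k) (hK.typing hS ha k) (hr.subst σ)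
  | .iapp hb ha =>
    rw [Tm.subst_inst (hK.lc k)]
    exact .iapp (hK.typing hS hb k) (hK.typing hS ha k)
  | .conv ha he hB =>
    exact .conv (hK.typing hS ha k) (hK.defEq hS he (hK.full k))
      (hK.typing hS hB k)
  | .cpi L h hφ =>
    have hφ' := hK.propWff hS hφ k
    obtain ⟨M, hM⟩ := hK.extCo k hφ'
    refine .cpi (L ∪ M) (fun c hc => ?_) hφ'
    rw [Finset.notMem_union] at hc
    exact hK.typing hS (h c hc.1) (hM c hc.2)
  | .cabs L h hφ =>
    have hφ' := hK.propWff hS hφ k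
    obtain ⟨M, hM⟩ := hK.extCo k hφ'
    refine .cabs (L ∪ M) (fun c hc => ?_) hφ'
    rw [Finset.notMem_union] at hc
    exact hK.typing hS (h c hc.1) (hM c hc.2)
  | .capp hd he => exact .capp (hK.typing hS hd k) (hK.defEq hS he (hK.full k))
  | .const _ hF hA =>
    rw [hA.subst_eq_self]
    exact .const (hK.ctx k) hF hA
  | .fam _ hF hA =>
    rw [hA.subst_eq_self]
    exact .fam (hK.ctx k) hF hA
  | .case ha hF hB hs h₁ h₂ =>
    exact .case (hK.typing hS ha k) (hK.typing hS hF k) (hB.subst (hK.lc k)) hs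
      (hK.typing hS h₁ k) (hK.typing hS h₂ k)
termination_by structural h

theorem SubstFamily.propWff {S : Signature} (hS : WfSignature S)
    {K : Context → Finset Name → (Name → Tm) → Context → Finset Name → Prop}
    (hK : SubstFamily S K) {Γ φ} (h : PropWff S Γ φ) {Δ σ Γ' Δ'} (k : K Γ Δ σ Γ' Δ') :
    PropWff S Γ' (φ.subst σ) := by
  match h with
  | .wff ha hb hA =>
    exact .wff (hK.typing hS ha k) (hK.typing hS hb k) (hK.typing hS hA k)
termination_by structural h

theorem SubstFamily.iso {S : Signature} (hS : WfSignature S)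
    {K : Context → Finset Name → (Name → Tm) → Context → Finset Name → Prop}
    (hK : SubstFamily S K) {Γ Δ φ₁ φ₂} (h : Iso S Γ Δ φ₁ φ₂) {σ Γ' Δ'} (k : K Γ Δ σ Γ' Δ') :
    Iso S Γ' Δ' (φ₁.subst σ) (φ₂.subst σ) := by
  match h with
  | .propCong ha hb => exact .propCong (hK.defEq hS ha k) (hK.defEq hS hb k)
  | .isoConv hA h₁ h₂ =>
    exact .isoConv (hK.defEq hS hA k) (hK.propWff hS h₁ k) (hK.propWff hS h₂ k)
  | .cpiFst h => exact .cpiFst (hK.defEq hS h k)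
termination_by structural h

theorem SubstFamily.defEq {S : Signature} (hS : WfSignature S)
    {K : Context → Finset Name → (Name → Tm) → Context → Finset Name → Prop}
    (hK : SubstFamily S K) {Γ Δ a b A R} (h : DefEq S Γ Δ a b A R) {σ Γ' Δ'}
    (k : K Γ Δ σ Γ' Δ') : DefEq S Γ' Δ' (a.subst σ) (b.subst σ) (A.subst σ) R := by
  match h with
  | .assn _ hc hΔ => exact hK.co k hc hΔ
  | .refl h => exact .refl (hK.typing hS h k)
  | .symm h => exact .symm (hK.defEq hS h k)
  | .trans h₁ h₂ => exact .trans (hK.defEq hS h₁ k) (hK.defEq hS h₂ k)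
  | .sub h hR => exact .sub (hK.defEq hS h k) hR
  | .beta ha hb h =>
    exact .beta (hK.typing hS ha k) (hK.typing hS hb k) (h.subst hS (hK.lc k))
  | .piCong (B₁ := B₁) (B₂ := B₂) L hA hB hA₁ h₁ h₂ =>
    have hA₁' := hK.typing hS hA₁ k
    obtain ⟨M, hM⟩ := hK.extTm k hA₁'
    refine .piCong (L ∪ M ∪ B₁.fv ∪ B₂.fv) (hK.defEq hS hA k) (fun x hx => ?_) hA₁'
      (hK.typing hS h₁ k) (hK.typing hS h₂ k)
    simp only [Finset.notMem_union] at hx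
    rw [← Tm.subst_lift_opn (hK.lc k) hx.1.2, ← Tm.subst_lift_opn (hK.lc k) hx.2]
    exact hK.defEq hS (hB x hx.1.1.1) (hM x hx.1.1.2)
  | .absCong (b₁ := b₁) (b₂ := b₂) (B := B) L h hA hρ₁ hρ₂ =>
    have hA' := hK.typing hS hA k
    obtain ⟨M, hM⟩ := hK.extTm k hA'
    refine .absCong (L ∪ M ∪ (b₁.fv ∪ b₂.fv ∪ B.fv) ∪ ((b₁.subst σ).fv ∪ (b₂.subst σ).fv))
      (fun x hx => ?_) hA' (fun x hx => ?_) (fun x hx => ?_) <;>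
      simp only [Finset.notMem_union] at hx <;>
      obtain ⟨⟨⟨hL, hM'⟩, ⟨h₁, h₂⟩, h₃⟩, h₁', h₂'⟩ := hx
    · rw [← Tm.subst_lift_opn (hK.lc k) h₁, ← Tm.subst_lift_opn (hK.lc k) h₂,
        ← Tm.subst_lift_opn (hK.lc k) h₃]
      exact hK.defEq hS (h x hL) (hM x hM')
    · exact (hρ₁ x hL).subst (hK.lc k) h₁ h₁'
    · exact (hρ₂ x hL).subst (hK.lc k) h₂ h₂'
  | .appCong h₁ h₂ =>
    rw [Tm.subst_inst (hK.lc k)]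
    exact .appCong (hK.defEq hS h₁ k) (hK.defEq hS h₂ k)
  | .tappCong h₁ h₂ hr₁ hr₂ ht =>
    have ht' := hK.typing hS ht k
    rw [Tm.subst_inst (hK.lc k)] at ht' ⊢
    exact .tappCong (hK.defEq hS h₁ k) (hK.defEq hS h₂ k) (hr₁.subst σ) (hr₂.subst σ)
      ht'
  | .iappCong h ha =>
    rw [Tm.subst_inst (hK.lc k)]
    exact .iappCong (hK.defEq hS h k) (hK.typing hS ha k)
  | .piFst h => exact .piFst (hK.defEq hS h k)
  | .piSnd h ha =>
    rw [Tm.subst_inst (hK.lc k), Tm.subst_inst (hK.lc k)]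
    exact .piSnd (hK.defEq hS h k) (hK.defEq hS ha k)
  | .cpiCong L hφ hB hφ₁ h₁ h₂ =>
    have hφ₁' := hK.propWff hS hφ₁ k
    obtain ⟨M, hM⟩ := hK.extCo k hφ₁'
    refine .cpiCong (L ∪ M) (hK.iso hS hφ k) (fun c hc => ?_) hφ₁'
      (hK.typing hS h₁ k) (hK.typing hS h₂ k)
    rw [Finset.notMem_union] at hc
    exact hK.defEq hS (hB c hc.1) (hM c hc.2)
  | .cabsCong L h hφ =>
    have hφ' := hK.propWff hS hφ k
    obtain ⟨M, hM⟩ := hK.extCo k hφ'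
    refine .cabsCong (L ∪ M) (fun c hc => ?_) hφ'
    rw [Finset.notMem_union] at hc
    exact hK.defEq hS (h c hc.1) (hM c hc.2)
  | .cappCong h he =>
    exact .cappCong (hK.defEq hS h k) (hK.defEq hS he (hK.full k))
  | .cpiSnd h h₁ h₂ =>
    exact .cpiSnd (hK.defEq hS h k) (hK.defEq hS h₁ (hK.full k))
      (hK.defEq hS h₂ (hK.full k))
  | .cast h hφ => exact .cast (hK.defEq hS h k) (hK.iso hS hφ k)
  | .eqConv h he => exact .eqConv (hK.defEq hS h k) (hK.defEq hS he (hK.full k))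
  | .isoSnd h => exact .isoSnd (hK.iso hS h k)
  | .patCong ha hF hB hB' hs he h₁ h₂ =>
    exact .patCong (hK.defEq hS ha k) (hK.typing hS hF k) (hB.subst (hK.lc k))
      (hB'.subst (hK.lc k)) hs (hK.defEq hS he (hK.full k)) (hK.defEq hS h₁ k)
      (hK.defEq hS h₂ k)
  | .leftRel hp hp' ha hb ha' hb' h he =>
    have h := hK.defEq hS h k
    have he := hK.defEq hS he (hK.full k)
    rw [Tm.subst_inst (hK.lc k)] at h he
    rw [Tm.subst_inst (hK.lc k)] at he
    exact .leftRel (hp.subst σ) (hp'.subst σ) (hK.typing hS ha k) (hK.typing hS hb k)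
      (hK.typing hS ha' k) (hK.typing hS hb' k) h he
  | .leftIrr hp hp' ha hb ha' hb' h he =>
    have h := hK.defEq hS h k
    have he := hK.defEq hS he (hK.full k)
    rw [Tm.subst_inst (hK.lc k)] at h he
    rw [Tm.subst_inst (hK.lc k)] at he
    exact .leftIrr (hp.subst σ) (hp'.subst σ) (hK.typing hS ha k) (hK.typing hS hb k)
      (hK.typing hS ha' k) (hK.typing hS hb' k) h he
  | .right hp hp' ha hb ha' hb' h he =>
    have h := hK.defEq hS h k
    have he := hK.defEq hS he (hK.full k)
    rw [Tm.subst_inst (hK.lc k)] at h he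
    rw [Tm.subst_inst (hK.lc k)] at he
    exact .right (hp.subst σ) (hp'.subst σ) (hK.typing hS ha k) (hK.typing hS hb k)
      (hK.typing hS ha' k) (hK.typing hS hb' k) h he
  | .cLeft hp hp' hd hd' he h =>
    exact .cLeft (hp.subst σ) (hp'.subst σ) (hK.typing hS hd k) (hK.typing hS hd' k)
      (hK.defEq hS he (hK.full k)) (hK.defEq hS h k)
termination_by structural h

end

/-! ### Weakening -/

/-- The identity from a context into a larger well-formed one that makes at least the same
coercions available. -/
structure Weakening (S : Signature) (Γ : Context) (Δ : Finset Name) (σ : Name → Tm) (Γ' : Context)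
    (Δ' : Finset Name) : Prop where
  eq_fvar : σ = Tm.fvar
  ctx : Ctx S Γ'
  mem : ∀ x e, (x, e) ∈ Γ → (x, e) ∈ Γ'
  avail : ∀ c e, (c, e) ∈ Γ → c ∈ Δ → c ∈ Δ'

theorem Constraint.subst_fvar (φ : Constraint) : φ.subst Tm.fvar = φ := by
  simp [Constraint.subst, Tm.subst_fvar]

theorem Weakening.substFamily (S : Signature) : SubstFamily S (Weakening S) where
  lc := by
    rintro _ _ _ _ _ ⟨rfl, _, _, _⟩ x
    exact Tm.LC.fvar x
  ctx k := k.ctx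
  full k := ⟨k.eq_fvar, k.ctx, k.mem, fun c e h _ => mem_dom_of_mem (k.mem c e h)⟩
  var := by
    rintro _ _ _ _ _ x A ⟨rfl, hΓ, hm, _⟩ h
    rw [Tm.subst_fvar]
    exact .var hΓ (hm _ _ h)
  co := by
    rintro _ _ _ _ _ c a b A R ⟨rfl, hΓ, hm, hΔ⟩ h hc
    simp only [Tm.subst_fvar]
    exact .assn hΓ (hm _ _ h) (hΔ _ _ h hc)
  extTm := by
    rintro Γ Δ _ Γ' Δ' A ⟨rfl, hΓ, hm, hΔ⟩ hA
    refine ⟨dom Γ' ∪ Δ, fun x hx => ?_⟩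
    rw [Finset.notMem_union] at hx
    refine ⟨lift_fvar x, .consTm hΓ hA hx.1, fun y e h => ?_, fun y e h hy => ?_⟩
    · rw [Tm.subst_fvar]
      exact List.cons_subset_cons _ (fun p => hm p.1 p.2) h
    · rcases List.mem_cons.1 h with h | h
      · cases h
        exact absurd hy hx.2
      · exact hΔ _ _ h hy
  extCo := by
    rintro Γ Δ _ Γ' Δ' φ ⟨rfl, hΓ, hm, hΔ⟩ hφ
    refine ⟨dom Γ' ∪ Δ, fun x hx => ?_⟩
    rw [Finset.notMem_union] at hx
    refine ⟨rfl, .consCo hΓ hφ hx.1, fun y e h => ?_, fun y e h hy => ?_⟩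
    · rw [Constraint.subst_fvar]
      exact List.cons_subset_cons _ (fun p => hm p.1 p.2) h
    · rcases List.mem_cons.1 h with h | h
      · cases h
        exact absurd hy hx.2
      · exact hΔ _ _ h hy

theorem Weakening.of_subset {S : Signature} {Γ Γ' : Context} (hΓ' : Ctx S Γ') (h : Γ ⊆ Γ') :
    Weakening S Γ (dom Γ) Tm.fvar Γ' (dom Γ') :=
  ⟨rfl, hΓ', fun _ _ h' => h h', fun _ _ h' _ => mem_dom_of_mem (h h')⟩

theorem Typing.weaken {S : Signature} (hS : WfSignature S) {Γ Γ' : Context} {a A : Tm}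
    (h : Typing S Γ a A) (hΓ' : Ctx S Γ') (hsub : Γ ⊆ Γ') : Typing S Γ' a A := by
  simpa only [Tm.subst_fvar] using
    (Weakening.substFamily S).typing hS h (.of_subset hΓ' hsub)

theorem PropWff.weaken {S : Signature} (hS : WfSignature S) {Γ Γ' : Context} {φ : Constraint}
    (h : PropWff S Γ φ) (hΓ' : Ctx S Γ') (hsub : Γ ⊆ Γ') : PropWff S Γ' φ := by
  simpa only [Constraint.subst_fvar] using
    (Weakening.substFamily S).propWff hS h (.of_subset hΓ' hsub)

theorem Iso.weaken {S : Signature} (hS : WfSignature S) {Γ Γ' : Context} {φ₁ φ₂ : Constraint}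
    (h : Iso S Γ (dom Γ) φ₁ φ₂) (hΓ' : Ctx S Γ') (hsub : Γ ⊆ Γ') :
    Iso S Γ' (dom Γ') φ₁ φ₂ := by
  simpa only [Constraint.subst_fvar] using
    (Weakening.substFamily S).iso hS h (.of_subset hΓ' hsub)

theorem DefEq.weaken_of_avail {S : Signature} (hS : WfSignature S) {Γ Γ' : Context}
    {Δ Δ' : Finset Name} {a b A : Tm} {R : Role} (h : DefEq S Γ Δ a b A R) (hΓ' : Ctx S Γ')
    (hsub : Γ ⊆ Γ') (hΔ : ∀ c e, (c, e) ∈ Γ → c ∈ Δ → c ∈ Δ') : DefEq S Γ' Δ' a b A R := by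
  simpa only [Tm.subst_fvar] using
    (Weakening.substFamily S).defEq hS h ⟨rfl, hΓ', fun _ _ h' => hsub h', hΔ⟩

theorem DefEq.weaken {S : Signature} (hS : WfSignature S) {Γ Γ' : Context} {a b A : Tm} {R : Role}
    (h : DefEq S Γ (dom Γ) a b A R) (hΓ' : Ctx S Γ') (hsub : Γ ⊆ Γ') :
    DefEq S Γ' (dom Γ') a b A R :=
  h.weaken_of_avail hS hΓ' hsub fun _ _ h _ => mem_dom_of_mem (hsub h)

/-- Every equality is a representational one with all coercions of the context available, which is
the form that conversion uses; coercions of `Δ` that the context does not bind play no role. -/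
theorem DefEq.rep_dom {S : Signature} (hS : WfSignature S) {Γ : Context} {Δ : Finset Name}
    {a b A : Tm} {R : Role} (h : DefEq S Γ Δ a b A R) (hΓ : Ctx S Γ) :
    DefEq S Γ (dom Γ) a b A .rep :=
  .sub (h.weaken_of_avail hS hΓ (List.Subset.refl _) fun _ _ h _ => mem_dom_of_mem h)
    (by cases R <;> trivial)

/-! ### Context morphisms -/

/-- A substitution from `Γ` to `Γ'` that sends variables to terms of the substituted type and
coercion assumptions to derivable equalities. The equalities coming from coercions of `Δ` must be
derivable from `Δ'`. -/
structure Morphism (S : Signature) (Γ : Context) (Δ : Finset Name) (σ : Name → Tm) (Γ' : Context)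
    (Δ' : Finset Name) : Prop where
  lc : ∀ x, (σ x).LC
  ctx : Ctx S Γ'
  var : ∀ x A, (x, .tm A) ∈ Γ → Typing S Γ' (σ x) (A.subst σ)
  co : ∀ c a b A R, (c, .co ⟨a, b, A, R⟩) ∈ Γ →
    DefEq S Γ' (dom Γ') (a.subst σ) (b.subst σ) (A.subst σ) R
  avail : ∀ c a b A R, (c, .co ⟨a, b, A, R⟩) ∈ Γ → c ∈ Δ →
    DefEq S Γ' Δ' (a.subst σ) (b.subst σ) (A.subst σ) R

/-- The free variables of the types and propositions of a context. -/
def ctxFv : Context → Finset Name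
  | [] => ∅
  | (_, .tm A) :: Γ => A.fv ∪ ctxFv Γ
  | (_, .co φ) :: Γ => φ.lhs.fv ∪ φ.rhs.fv ∪ φ.ty.fv ∪ ctxFv Γ

theorem fv_subset_ctxFv_of_mem_tm {Γ : Context} {x : Name} {A : Tm} (h : (x, .tm A) ∈ Γ) :
    A.fv ⊆ ctxFv Γ := by
  induction Γ with
  | nil => simp at h
  | cons e Γ ih =>
    rcases List.mem_cons.1 h with rfl | h'
    · exact Finset.subset_union_left
    · obtain ⟨y, _ | _⟩ := e <;> exact (ih h').trans Finset.subset_union_right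

theorem fv_subset_ctxFv_of_mem_co {Γ : Context} {c : Name} {φ : Constraint}
    (h : (c, .co φ) ∈ Γ) : φ.lhs.fv ∪ φ.rhs.fv ∪ φ.ty.fv ⊆ ctxFv Γ := by
  induction Γ with
  | nil => simp at h
  | cons e Γ ih =>
    rcases List.mem_cons.1 h with rfl | h'
    · exact Finset.subset_union_left
    · obtain ⟨y, _ | _⟩ := e <;> exact (ih h').trans Finset.subset_union_right

theorem Morphism.substFamily {S : Signature} (hS : WfSignature S) :
    SubstFamily S (Morphism S) where
  lc k := k.lc
  ctx k := k.ctx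
  full k := ⟨k.lc, k.ctx, k.var, k.co, fun c a b A R h _ => k.co c a b A R h⟩
  var k h := k.var _ _ h
  co k h hc := k.avail _ _ _ _ _ h hc
  extTm {Γ Δ σ Γ' Δ' A} k hA := by
    refine ⟨dom Γ ∪ dom Γ' ∪ ctxFv Γ ∪ A.fv, fun x hx => ?_⟩
    simp only [Finset.notMem_union] at hx
    obtain ⟨⟨⟨hΓ, hΓ'⟩, hfv⟩, hxA⟩ := hx
    have hctx : Ctx S ((x, .tm (A.subst σ)) :: Γ') := .consTm k.ctx hA hΓ'
    have hsub : Γ' ⊆ (x, .tm (A.subst σ)) :: Γ' := List.subset_cons_self _ _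
    refine ⟨lift_lc k.lc x, hctx, fun y B h => ?_, fun c a b B R h => ?_, fun c a b B R h hc => ?_⟩
    · rcases List.mem_cons.1 h with h | h
      · cases h
        rw [lift_self, Tm.subst_lift hxA]
        exact .var hctx (List.mem_cons_self ..)
      · rw [lift_of_ne σ (show y ≠ x from fun e => hΓ (e ▸ mem_dom_of_mem h)),
          Tm.subst_lift fun h' => hfv (fv_subset_ctxFv_of_mem_tm h h')]
        exact (k.var y B h).weaken hS hctx hsub
    · rcases List.mem_cons.1 h with h | h
      · cases h
      · have hn : x ∉ a.fv ∪ b.fv ∪ B.fv := fun h' => hfv (fv_subset_ctxFv_of_mem_co h h')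
        simp only [Finset.notMem_union] at hn
        rw [Tm.subst_lift hn.1.1, Tm.subst_lift hn.1.2, Tm.subst_lift hn.2]
        exact (k.co c a b B R h).weaken hS hctx hsub
    · rcases List.mem_cons.1 h with h | h
      · cases h
      · have hn : x ∉ a.fv ∪ b.fv ∪ B.fv := fun h' => hfv (fv_subset_ctxFv_of_mem_co h h')
        simp only [Finset.notMem_union] at hn
        rw [Tm.subst_lift hn.1.1, Tm.subst_lift hn.1.2, Tm.subst_lift hn.2]
        exact (k.avail c a b B R h hc).weaken_of_avail hS hctx hsub fun _ _ _ h => h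
  extCo {Γ Δ σ Γ' Δ' φ} k hφ := by
    -- A name outside `Δ` is not an available coercion, so `avail` asks nothing of the new one.
    refine ⟨dom Γ' ∪ Δ, fun c hc => ?_⟩
    rw [Finset.notMem_union] at hc
    have hctx : Ctx S ((c, .co (φ.subst σ)) :: Γ') := .consCo k.ctx hφ hc.1
    have hsub : Γ' ⊆ (c, .co (φ.subst σ)) :: Γ' := List.subset_cons_self _ _
    refine ⟨k.lc, hctx, fun y B h => ?_, fun d a b B R h => ?_, fun d a b B R h hd => ?_⟩
    · rcases List.mem_cons.1 h with h | h
      · cases h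
      · exact (k.var y B h).weaken hS hctx hsub
    · rcases List.mem_cons.1 h with h | h
      · cases h
        exact .assn hctx (List.mem_cons_self ..) (mem_dom_of_mem (List.mem_cons_self ..))
      · exact (k.co d a b B R h).weaken hS hctx hsub
    · rcases List.mem_cons.1 h with h | h
      · cases h
        exact absurd hd hc.2
      · exact (k.avail d a b B R h hd).weaken_of_avail hS hctx hsub fun _ _ _ h => h

/-- Instantiation of the variable bound in a dependent type. -/
theorem Typing.inst_star {S : Signature} (hS : WfSignature S) {Γ : Context} {A B u : Tm}
    {L : Finset Name} (h : ∀ x ∉ L, Typing S ((x, .tm A) :: Γ) (B.opn x) .star)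
    (hu : Typing S Γ u A) : Typing S Γ (B.inst u) .star := by
  obtain ⟨x, hx⟩ := exists_name_notMem (L ∪ dom Γ ∪ ctxFv Γ ∪ A.fv ∪ B.fv)
  simp only [Finset.notMem_union] at hx
  obtain ⟨⟨⟨⟨hL, hΓ⟩, hfv⟩, hA⟩, hB⟩ := hx
  have k : Morphism S ((x, .tm A) :: Γ) ∅ (single x u) Γ ∅ := by
    refine ⟨single_lc hu.lc x, hu.ctx, fun y C h => ?_, fun c a b C R h => ?_,
      fun _ _ _ _ _ _ h => absurd h (Finset.notMem_empty _)⟩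
    · rcases List.mem_cons.1 h with h | h
      · cases h
        rwa [single_self, Tm.subst_single hA]
      · rw [single_of_ne (show y ≠ x from fun e => hΓ (e ▸ mem_dom_of_mem h)),
          Tm.subst_single fun h' => hfv (fv_subset_ctxFv_of_mem_tm h h')]
        exact .var hu.ctx h
    · rcases List.mem_cons.1 h with h | h
      · cases h
      · have hn : x ∉ a.fv ∪ b.fv ∪ C.fv := fun h' => hfv (fv_subset_ctxFv_of_mem_co h h')
        simp only [Finset.notMem_union] at hn
        rw [Tm.subst_single hn.1.1, Tm.subst_single hn.1.2, Tm.subst_single hn.2]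
        exact .assn hu.ctx h (mem_dom_of_mem h)
  rw [← Tm.subst_single_opn hu.lc hB]
  exact (Morphism.substFamily hS).typing hS (h x hL) k

/-- Discharging a coercion assumption by a derivation of it. -/
theorem Typing.discharge {S : Signature} (hS : WfSignature S) {Γ : Context} {a b A B C : Tm}
    {R : Role} {L : Finset Name} (h : ∀ c ∉ L, Typing S ((c, .co ⟨a, b, A, R⟩) :: Γ) B C)
    (hΓ : Ctx S Γ) (he : DefEq S Γ (dom Γ) a b A R) : Typing S Γ B C := by
  obtain ⟨c, hc⟩ := exists_name_notMem L
  have k : Morphism S ((c, .co ⟨a, b, A, R⟩) :: Γ) ∅ Tm.fvar Γ ∅ := by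
    refine ⟨Tm.LC.fvar, hΓ, fun y C h => ?_, fun d a' b' C R h => ?_,
      fun _ _ _ _ _ _ h => absurd h (Finset.notMem_empty _)⟩ <;> simp only [Tm.subst_fvar]
    · rcases List.mem_cons.1 h with h | h
      · cases h
      · exact .var hΓ h
    · rcases List.mem_cons.1 h with h | h
      · cases h
        exact he
      · exact .assn hΓ h (mem_dom_of_mem h)
  simpa only [Tm.subst_fvar] using (Morphism.substFamily hS).typing hS (h c hc) k

/-! ### Regularity -/

theorem Ctx.typing_of_mem {S : Signature} (hS : WfSignature S) {Γ : Context} (hΓ : Ctx S Γ)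
    {x : Name} {A : Tm} (h : (x, .tm A) ∈ Γ) : Typing S Γ A .star := by
  induction Γ with
  | nil => simp at h
  | cons e Γ ih =>
    have hsub : Γ ⊆ e :: Γ := List.subset_cons_self _ _
    rcases List.mem_cons.1 h with h | h
    · subst h
      cases hΓ with | consTm hΓ' hA hx =>
      exact hA.weaken hS (.consTm hΓ' hA hx) hsub
    · refine (ih ?_ h).weaken hS hΓ hsub
      cases hΓ <;> assumption

theorem Ctx.propWff_of_mem {S : Signature} (hS : WfSignature S) {Γ : Context} (hΓ : Ctx S Γ)
    {c : Name} {φ : Constraint} (h : (c, .co φ) ∈ Γ) : PropWff S Γ φ := by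
  induction Γ with
  | nil => simp at h
  | cons e Γ ih =>
    have hsub : Γ ⊆ e :: Γ := List.subset_cons_self _ _
    rcases List.mem_cons.1 h with h | h
    · subst h
      cases hΓ with | consCo hΓ' hφ hc =>
      exact hφ.weaken hS (.consCo hΓ' hφ hc) hsub
    · refine (ih ?_ h).weaken hS hΓ hsub
      cases hΓ <;> assumption

/-- Inversion for `Π`-types. The subject is a variable `t`, as structural recursion requires. -/
theorem Typing.pi_inv_of_eq {S Γ t T ρ A B} (h : Typing S Γ t T) (ht : t = .pi ρ A B) :
    Typing S Γ A .star ∧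
      ∃ L : Finset Name, ∀ x ∉ L, Typing S ((x, .tm A) :: Γ) (B.opn x) .star := by
  match h with
  | .pi L hB hA =>
    cases ht
    exact ⟨hA, L, hB⟩
  | .conv h _ _ => exact h.pi_inv_of_eq ht
termination_by structural h

theorem Typing.pi_inv {S Γ ρ A B T} (h : Typing S Γ (.pi ρ A B) T) :
    Typing S Γ A .star ∧
      ∃ L : Finset Name, ∀ x ∉ L, Typing S ((x, .tm A) :: Γ) (B.opn x) .star :=
  h.pi_inv_of_eq rfl

/-- Inversion for `∀`-types. The subject is a variable `t`, as structural recursion requires. -/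
theorem Typing.cpi_inv_of_eq {S Γ t a b A R B T} (h : Typing S Γ t T) (ht : t = .cpi a b A R B) :
    PropWff S Γ ⟨a, b, A, R⟩ ∧
      ∃ L : Finset Name, ∀ c ∉ L, Typing S ((c, .co ⟨a, b, A, R⟩) :: Γ) B .star := by
  match h with
  | .cpi L hB hφ =>
    cases ht
    exact ⟨hφ, L, hB⟩
  | .conv h _ _ => exact h.cpi_inv_of_eq ht
termination_by structural h

theorem Typing.cpi_inv {S Γ a b A R B T} (h : Typing S Γ (.cpi a b A R B) T) :
    PropWff S Γ ⟨a, b, A, R⟩ ∧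
      ∃ L : Finset Name, ∀ c ∉ L, Typing S ((c, .co ⟨a, b, A, R⟩) :: Γ) B .star :=
  h.cpi_inv_of_eq rfl

theorem Typing.pi_inst {S : Signature} (hS : WfSignature S) {Γ : Context} {ρ : Relevance}
    {A B T u : Tm} (h : Typing S Γ (.pi ρ A B) T) (hu : Typing S Γ u A) :
    Typing S Γ (B.inst u) .star :=
  have ⟨_, _, hB⟩ := h.pi_inv
  Typing.inst_star hS hB hu

theorem Typing.cpi_discharge {S : Signature} (hS : WfSignature S) {Γ : Context}
    {a b A B T : Tm} {R : Role} (h : Typing S Γ (.cpi a b A R B) T)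
    (he : DefEq S Γ (dom Γ) a b A R) : Typing S Γ B .star :=
  have ⟨_, _, hB⟩ := h.cpi_inv
  Typing.discharge hS hB h.ctx he

theorem Typing.type_typing {S : Signature} (hS : WfSignature S) {Γ a A} :
    Typing S Γ a A → Typing S Γ A .star
  | .star h => .star h
  | .var hΓ h => hΓ.typing_of_mem hS h
  | .pi _ _ h => .star h.ctx
  | .abs L h hA _ => .pi L (fun x hx => (h x hx).type_typing hS) hA
  | .app hb ha => (hb.type_typing hS).pi_inst hS ha
  | .tapp hb ha _ => (hb.type_typing hS).pi_inst hS ha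
  | .iapp hb ha => (hb.type_typing hS).pi_inst hS ha
  | .conv _ _ hB => hB
  | .cpi _ _ hφ => .star hφ.ctx
  | .cabs L h hφ => .cpi L (fun c hc => (h c hc).type_typing hS) hφ
  | .capp hd he => (hd.type_typing hS).cpi_discharge hS he
  | .const hΓ _ hA => hA.weaken hS hΓ (List.nil_subset _)
  | .fam hΓ _ hA => hA.weaken hS hΓ (List.nil_subset _)
  | .case _ _ _ _ _ h₂ => h₂.type_typing hS

/-- Equal arguments give equal instances of the codomain of a `Π`-type. -/
theorem DefEq.inst_rep {S : Signature} (hS : WfSignature S) {Γ : Context} {Δ : Finset Name}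
    {ρ : Relevance} {A B T u v : Tm} (h : Typing S Γ (.pi ρ A B) T)
    (he : DefEq S Γ Δ u v A .nom) :
    DefEq S Γ (dom Γ) (B.inst u) (B.inst v) .star .rep := by
  obtain ⟨hA, L, hB⟩ := h.pi_inv
  exact (DefEq.piSnd (.refl (.pi (ρ := ρ) L hB hA)) he).rep_dom (R := .nom) hS h.ctx

mutual

theorem Iso.propWff {S : Signature} (hS : WfSignature S) {Γ Δ φ₁ φ₂} (h : Iso S Γ Δ φ₁ φ₂) :
    PropWff S Γ φ₁ ∧ PropWff S Γ φ₂ := by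
  match h with
  | .propCong ha hb =>
    obtain ⟨ha₁, ha₂⟩ := ha.typing hS
    obtain ⟨hb₁, hb₂⟩ := hb.typing hS
    have hA := ha₁.type_typing hS
    exact ⟨.wff ha₁ hb₁ hA, .wff ha₂ hb₂ hA⟩
  | .isoConv _ h₁ h₂ => exact ⟨h₁, h₂⟩
  | .cpiFst h =>
    obtain ⟨h₁, h₂⟩ := h.typing hS
    exact ⟨h₁.cpi_inv.1, h₂.cpi_inv.1⟩
termination_by structural h

theorem DefEq.typing {S : Signature} (hS : WfSignature S) {Γ Δ a b A R}
    (h : DefEq S Γ Δ a b A R) : Typing S Γ a A ∧ Typing S Γ b A := by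
  match h with
  | .assn hΓ h _ =>
    cases hΓ.propWff_of_mem hS h with | wff ha hb _ =>
    exact ⟨ha, hb⟩
  | .refl h => exact ⟨h, h⟩
  | .symm h => exact (h.typing hS).symm
  | .trans h₁ h₂ => exact ⟨(h₁.typing hS).1, (h₂.typing hS).2⟩
  | .sub h _ => exact h.typing hS
  | .beta ha hb _ => exact ⟨ha, hb⟩
  | .piCong _ _ _ _ h₁ h₂ => exact ⟨h₁, h₂⟩
  | .absCong L h hA hρ₁ hρ₂ =>
    exact ⟨.abs L (fun x hx => ((h x hx).typing hS).1) hA hρ₁,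
      .abs L (fun x hx => ((h x hx).typing hS).2) hA hρ₂⟩
  | .appCong h₁ h₂ =>
    -- The right-hand side has type `B{b₂/x}`, which has to be converted to `B{a₂/x}`.
    obtain ⟨ha₁, hb₁⟩ := h₁.typing hS
    obtain ⟨ha₂, hb₂⟩ := h₂.typing hS
    have hPi := ha₁.type_typing hS
    exact ⟨.app ha₁ ha₂, .conv (.app hb₁ hb₂) (.symm (DefEq.inst_rep hS hPi h₂))
      (hPi.pi_inst hS ha₂)⟩
  | .tappCong h₁ h₂ hr₁ _ ht =>
    exact ⟨.tapp (h₁.typing hS).1 (h₂.typing hS).1 hr₁, ht⟩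
  | .iappCong h ha => exact ⟨.iapp (h.typing hS).1 ha, .iapp (h.typing hS).2 ha⟩
  | .piFst h => exact ⟨(h.typing hS).1.pi_inv.1, (h.typing hS).2.pi_inv.1⟩
  | .piSnd h ha =>
    obtain ⟨h₁, h₂⟩ := h.typing hS
    obtain ⟨ha₁, ha₂⟩ := ha.typing hS
    exact ⟨h₁.pi_inst hS ha₁, h₂.pi_inst hS
      (.conv ha₂ ((DefEq.piFst h).rep_dom hS h₁.ctx) h₂.pi_inv.1)⟩
  | .cpiCong _ _ _ _ h₁ h₂ => exact ⟨h₁, h₂⟩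
  | .cabsCong L h hφ =>
    exact ⟨.cabs L (fun c hc => ((h c hc).typing hS).1) hφ,
      .cabs L (fun c hc => ((h c hc).typing hS).2) hφ⟩
  | .cappCong h he => exact ⟨.capp (h.typing hS).1 he, .capp (h.typing hS).2 he⟩
  | .cpiSnd h h₁ h₂ =>
    exact ⟨(h.typing hS).1.cpi_discharge hS h₁, (h.typing hS).2.cpi_discharge hS h₂⟩
  | .cast _ hφ =>
    cases (hφ.propWff hS).2 with | wff ha hb _ =>
    exact ⟨ha, hb⟩
  | .eqConv h he =>
    obtain ⟨ha, hb⟩ := h.typing hS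
    have hB := (he.typing hS).2
    exact ⟨.conv ha he hB, .conv hb he hB⟩
  | .isoSnd hφ =>
    obtain ⟨⟨_, _, hA⟩, ⟨_, _, hA'⟩⟩ := hφ.propWff hS
    exact ⟨hA, hA'⟩
  | .patCong ha hF hB hB' hs he h₁ h₂ =>
    exact ⟨.case (ha.typing hS).1 hF hB hs (h₁.typing hS).1 (h₂.typing hS).1,
      .case (ha.typing hS).2 hF hB' hs (.conv (h₁.typing hS).2 he (he.typing hS).2)
        (h₂.typing hS).2⟩
  | .leftRel _ _ ha _ ha' _ _ _ => exact ⟨ha, ha'⟩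
  | .leftIrr _ _ ha _ ha' _ _ _ => exact ⟨ha, ha'⟩
  | .right _ _ _ hb _ hb' _ _ => exact ⟨hb, hb'⟩
  | .cLeft _ _ hd hd' _ _ => exact ⟨hd, hd'⟩
termination_by structural h

end

theorem Iso.symm {S : Signature} {Γ : Context} {Δ : Finset Name} {φ₁ φ₂ : Constraint}
    (h : Iso S Γ Δ φ₁ φ₂) : Iso S Γ Δ φ₂ φ₁ := by
  cases h with
  | propCong ha hb => exact .propCong (.symm ha) (.symm hb)
  | isoConv hA h₁ h₂ => exact .isoConv (.symm hA) h₂ h₁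
  | cpiFst h => exact .cpiFst (.symm h)

/-! ### Context conversion -/

theorem CtxEq.dom_eq {S : Signature} {Γ₁ Γ₂ : Context} (h : CtxEq S Γ₁ Γ₂) :
    dom Γ₁ = dom Γ₂ := by
  induction h with
  | empty => rfl
  | consTm _ _ ih => rw [dom_cons, dom_cons, ih]
  | consCo _ _ ih => rw [dom_cons, dom_cons, ih]

/-- The identity is a morphism between equal contexts. An entry of the second context is first
seen to be well-formed in the first one, by regularity, and then transported along the morphism
between the shorter contexts, as is its equality with the corresponding entry of the first. -/
theorem CtxEq.morphism {S : Signature} (hS : WfSignature S) {Γ₁ Γ₂ : Context}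
    (h : CtxEq S Γ₁ Γ₂) (hΓ₁ : Ctx S Γ₁) : Morphism S Γ₁ (dom Γ₁) Tm.fvar Γ₂ (dom Γ₂) := by
  have of_id {Γ₁ Γ₂ : Context} (hctx : Ctx S Γ₂)
      (var : ∀ x A, (x, .tm A) ∈ Γ₁ → Typing S Γ₂ (.fvar x) A)
      (co : ∀ c a b A R, (c, .co ⟨a, b, A, R⟩) ∈ Γ₁ → DefEq S Γ₂ (dom Γ₂) a b A R) :
      Morphism S Γ₁ (dom Γ₁) Tm.fvar Γ₂ (dom Γ₂) := by
    refine ⟨Tm.LC.fvar, hctx, ?_, ?_, ?_⟩ <;> simp only [Tm.subst_fvar]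
    · exact var
    · exact co
    · exact fun c a b A R h _ => co c a b A R h
  induction h with
  | empty => exact of_id .empty (by simp) (by simp)
  | @consTm Γ₁ Γ₂ x A₁ A₂ hΓ he ih =>
    cases hΓ₁ with | consTm hΓ₁ hA₁ hx =>
    have k := ih hΓ₁
    have he' := (Morphism.substFamily hS).defEq hS he k
    have hA₁' := (Morphism.substFamily hS).typing hS (he.typing hS).1 k
    have hA₂' := (Morphism.substFamily hS).typing hS (he.typing hS).2 k
    simp only [Tm.subst_fvar, Tm.subst] at he' hA₁' hA₂'
    have hctx : Ctx S ((x, .tm A₂) :: Γ₂) := .consTm k.ctx hA₂' (hΓ.dom_eq ▸ hx)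
    have hsub : Γ₂ ⊆ (x, .tm A₂) :: Γ₂ := List.subset_cons_self _ _
    refine of_id hctx (fun y B h => ?_) (fun c a b B R h => ?_) <;>
      rcases List.mem_cons.1 h with h | h
    · cases h
      exact .conv (.var hctx (List.mem_cons_self ..)) (.symm (he'.weaken hS hctx hsub))
        (hA₁'.weaken hS hctx hsub)
    · have := k.var y B h
      rw [Tm.subst_fvar] at this
      exact this.weaken hS hctx hsub
    · cases h
    · have := k.co c a b B R h
      simp only [Tm.subst_fvar] at this
      exact this.weaken hS hctx hsub
  | @consCo Γ₁ Γ₂ c φ₁ φ₂ hΓ he ih =>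
    cases hΓ₁ with | consCo hΓ₁ hφ₁ hc =>
    have k := ih hΓ₁
    have he' := (Morphism.substFamily hS).iso hS he k
    have hφ₂' := (Morphism.substFamily hS).propWff hS (he.propWff hS).2 k
    simp only [Constraint.subst_fvar] at he' hφ₂'
    have hctx : Ctx S ((c, .co φ₂) :: Γ₂) := .consCo k.ctx hφ₂' (hΓ.dom_eq ▸ hc)
    have hsub : Γ₂ ⊆ (c, .co φ₂) :: Γ₂ := List.subset_cons_self _ _
    refine of_id hctx (fun y B h => ?_) (fun d a b B R h => ?_) <;>
      rcases List.mem_cons.1 h with h | h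
    · cases h
    · have := k.var y B h
      rw [Tm.subst_fvar] at this
      exact this.weaken hS hctx hsub
    · cases h
      exact .cast (.assn hctx (List.mem_cons_self ..) (mem_dom_of_mem (List.mem_cons_self ..)))
        (he'.weaken hS hctx hsub).symm
    · have := k.co d a b B R h
      simp only [Tm.subst_fvar] at this
      exact this.weaken hS hctx hsub

end DR

theorem mainTheorem9 (S : DR.Signature) (hS : DR.WfSignature S)
    (Γ₁ Γ₂ : DR.Context) (a A : DR.Tm)
    (hty : DR.Typing S Γ₁ a A) (heq : DR.CtxEq S Γ₁ Γ₂) :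
    DR.Typing S Γ₂ a A := by
  simpa only [DR.Tm.subst_fvar] using
    (DR.Morphism.substFamily hS).typing hS hty (heq.morphism hS hty.ctx)
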